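/- A partial field is a pair $\mathbb{P}=(R,G)$, where $R$ is a commutative ring with unity and $G$ is a subgroup of the group of units of $R$ with $-1\in G$; we write $p\in\mathbb{P}$ if $p\in G\cup\{0\}$. A field $\mathbb{F}$ is regarded as the partial field $(\mathbb{F},\mathbb{F}^*)$. For disjoint finite sets $X,Y$, an $X\times Y$ matrix $A$ over $R$ is a $\mathbb{P}$-matrix if all its subdeterminants are in $\mathbb{P}$. It is a $\mathbb{P}$-representation of a finite matroid $M$ if $M$ is isomorphic to the matroid $M[A]$ on $X\cup Y$ whose bases are $X$ and all sets $X\triangle Z$ with $Z\subseteq X\cup Y$, $|X\cap Z|=|Y\cap Z|$ and $\det A[X\cap Z,Y\cap Z]\neq 0$. The matroid $M$ is dyadic if it has a representation over the dyadic partial field $\mathbb{D}=\left(\mathbb{Z}\left[\tfrac12\right],\langle -1,2\rangle\right)$. For $\mathbb{P}$-matrices $A,A'$, write $A\preceq A'$ if $A$ can be obtained from $A'$ by multiplying rows or columns by elements of $G$, deleting rows or columns, permuting rows or columns, and pivoting on nonzero entries. The cross ratios of $A$ are the elements of $\mathrm{Cr}(A)=\left\{p:\begin{bmatrix}1&1\\p&1\end{bmatrix}\preceq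 A\right\}$, and $A$ is $F$-confined if $\mathrm{Cr}(A)\subseteq F\cup\{0,1\}$. **Corollary.** A finite matroid $M$ is dyadic if and only if $M$ has a $\{2,6,10\}$-confined representation over $\mathrm{GF}(11)$, that is, a $\mathrm{GF}(11)$-representation $A$ with $\mathrm{Cr}(A)\subseteq\{0,1,2,6,10\}$. -/

import Mathlib

/-- A partial field `(R, G)` on a commutative ring `R`: a subgroup `G` of the group of units of `R`
that contains `-1`. -/
structure PartialField (R : Type*) [CommRing R] where
  /-- the distinguished group of units -/
  G : Subgroup Rˣ
  neg_one_mem : (-1 : Rˣ) ∈ G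

namespace PartialField

variable {R : Type*} [CommRing R]

/-- `p ∈ P` means that `p` is `0` or an element of the group `G`. -/
def Mem (P : PartialField R) (p : R) : Prop :=
  p = 0 ∨ ∃ u ∈ P.G, (u : R) = p

/-- `A` is a `P`-matrix: every subdeterminant of `A` (in particular, every entry) lies in `P`.
A square submatrix is given by an enumeration of its rows and one of its columns; another choice
changes the determinant at most by a sign. -/
def IsPMatrix (P : PartialField R) {X Y : Type} (A : Matrix X Y R) : Prop :=
  ∀ (k : ℕ) (f : Fin k ↪ X) (g : Fin k ↪ Y), P.Mem (A.submatrix f g).det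

/-- The family of bases of `M[A]`, for an `X × Y` matrix `A`: the sets `X △ Z` where `X ∩ Z` and
`Y ∩ Z` have the same size and `det A[X ∩ Z, Y ∩ Z] ≠ 0`. The disjoint union of the two label sets
is `X ⊕ Y`; below, `X ∩ Z` is the range of `f` and `Y ∩ Z` is the range of `g`. The set `X` itself
is the case `k = 0`, where the determinant is `1`. -/
def basisFamily {X Y : Type} (A : Matrix X Y R) : Set (Set (X ⊕ Y)) :=
  {B | ∃ (k : ℕ) (f : Fin k ↪ X) (g : Fin k ↪ Y), (A.submatrix f g).det ≠ 0 ∧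
    B = Sum.inl '' (Set.range f)ᶜ ∪ Sum.inr '' Set.range g}

/-- The `P`-matrix `A` is a `P`-representation of the matroid `M`, that is, `M ≅ M[A]`: there is a
bijection from the labels of `A` to the ground set of `M` under which the bases of `M` are exactly
the images of the members of `basisFamily A`. -/
def IsRepresentation (P : PartialField R) {X Y : Type} (A : Matrix X Y R)
    {α : Type*} (M : Matroid α) : Prop :=
  P.IsPMatrix A ∧ ∃ e : X ⊕ Y ↪ α, Set.range e = M.E ∧
    ∀ B : Set (X ⊕ Y), M.IsBase (e '' B) ↔ B ∈ basisFamily A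

/-- `M` is `P`-representable: it has a `P`-representation (with finitely many rows and columns). -/
def Representable (P : PartialField R) {α : Type*} (M : Matroid α) : Prop :=
  ∃ (X Y : Type) (_ : Finite X) (_ : Finite Y) (A : Matrix X Y R), P.IsRepresentation A M

open Classical in
/-- Multiply row `x` by `u`. -/
noncomputable def scaleRow {X Y : Type} (A : Matrix X Y R) (x : X) (u : Rˣ) : Matrix X Y R :=
  Matrix.of fun i j => if i = x then (u : R) * A i j else A i j

open Classical in
/-- Multiply column `y` by `u`. -/
noncomputable def scaleCol {X Y : Type} (A : Matrix X Y R) (y : Y) (u : Rˣ) : Matrix X Y R :=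
  Matrix.of fun i j => if j = y then (u : R) * A i j else A i j

open Classical in
/-- The pivot of `A` on the entry in row `x` and column `y`, whose value is the unit `u`. The new
row in position `x` carries the label `y` and the new column in position `y` the label `x`; as
labels play no role for minors of matrices, the index types are kept. -/
noncomputable def pivot {X Y : Type} (A : Matrix X Y R) (x : X) (y : Y) (u : Rˣ) : Matrix X Y R :=
  Matrix.of fun i j =>
    if i = x then
      if j = y then ((u⁻¹ : Rˣ) : R) else ((u⁻¹ : Rˣ) : R) * A x j
    else
      if j = y then -(((u⁻¹ : Rˣ) : R) * A i y)
      else A i j - ((u⁻¹ : Rˣ) : R) * A i y * A x j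

/-- `P.MinorOf A' A` means `A ≼ A'`: the matrix `A` can be obtained from the `P`-matrix `A'` by
multiplying rows and columns by elements of `G`, deleting rows and columns, permuting rows and
columns (both through `submatrix` along injections, which also allows renaming the labels), and
pivoting on nonzero entries (the nonzero entries of a `P`-matrix are its entries in `G`). -/
inductive MinorOf (P : PartialField R) {X' Y' : Type} (A' : Matrix X' Y' R) :
    ∀ {X Y : Type}, Matrix X Y R → Prop
  | refl : MinorOf P A' A'
  | scaleRow {X Y : Type} {A : Matrix X Y R} (hA : MinorOf P A' A) (x : X) (u : Rˣ)
      (hu : u ∈ P.G) : MinorOf P A' (PartialField.scaleRow A x u)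
  | scaleCol {X Y : Type} {A : Matrix X Y R} (hA : MinorOf P A' A) (y : Y) (u : Rˣ)
      (hu : u ∈ P.G) : MinorOf P A' (PartialField.scaleCol A y u)
  | submatrix {X Y X₁ Y₁ : Type} {A : Matrix X Y R} (hA : MinorOf P A' A) (f : X₁ ↪ X)
      (g : Y₁ ↪ Y) : MinorOf P A' (A.submatrix f g)
  | pivot {X Y : Type} {A : Matrix X Y R} (hA : MinorOf P A' A) (x : X) (y : Y) (u : Rˣ)
      (hu : u ∈ P.G) (hxy : A x y = (u : R)) : MinorOf P A' (PartialField.pivot A x y u)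

/-- The cross ratios of `A`: all `p` such that the `2 × 2` matrix with rows `(1, 1)` and `(p, 1)`
is `≼ A`. -/
def crossRatios (P : PartialField R) {X Y : Type} (A : Matrix X Y R) : Set R :=
  {p | P.MinorOf A !![1, 1; p, 1]}

/-- `A` is `F`-confined: all its cross ratios lie in `F ∪ {0, 1}`. -/
def IsConfined (P : PartialField R) (F : Set R) {X Y : Type} (A : Matrix X Y R) : Prop :=
  P.crossRatios A ⊆ F ∪ {0, 1}

/-- `M` has an `F`-confined representation over `P`. -/
def HasConfinedRepresentation (P : PartialField R) (F : Set R) {α : Type*} (M : Matroid α) :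
    Prop :=
  ∃ (X Y : Type) (_ : Finite X) (_ : Finite Y) (A : Matrix X Y R),
    P.IsRepresentation A M ∧ P.IsConfined F A

/-- A field `K` as the partial field `(K, K*)`. -/
def ofField (K : Type*) [Field K] : PartialField K where
  G := ⊤
  neg_one_mem := Subgroup.mem_top _

/-- The dyadic partial field `(ℤ[1/2], ⟨-1, 2⟩)`. -/
noncomputable def dyadic : PartialField (Localization.Away (2 : ℤ)) where
  G := Subgroup.closure
    {-1, (IsLocalization.Away.algebraMap_isUnit (S := Localization.Away (2 : ℤ)) (2 : ℤ)).unit}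
  neg_one_mem := Subgroup.subset_closure (Set.mem_insert _ _)

end PartialField

/-- A matroid is dyadic if it is representable over the dyadic partial field. -/
def Matroid.IsDyadic {α : Type*} (M : Matroid α) : Prop :=
  PartialField.dyadic.Representable M

/-- `11` is prime, so that `ZMod 11` is the field `GF(11)`. -/
instance fact_prime_eleven : Fact (Nat.Prime 11) := ⟨by norm_num⟩

/-! Reduction modulo 11 is a ring homomorphism from ℤ[1/2] to GF(11) that sends every ±2^k to a
nonzero residue. So a subdeterminant of a dyadic matrix vanishes exactly when its reduction does,
and the matrix and its reduction have the same bases. Minor operations on the reduction can be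
mirrored upstairs. Hence its cross ratios are residues of elements p with p and 1 - p both dyadic,
namely 0, 1, -1, 2, 1/2, and these reduce to 0, 1, 10, 2, 6 (`isConfined_map`).

Conversely, every confined matrix over GF(11) lifts (`Confined.liftable`), by induction on the
number of rows and columns. If the support graph is connected with a vertex of degree at least
three, it has a spanning tree with three leaves. Two of these are on the same side, say columns x
and y, and the rows stay connected when both are deleted. By induction the matrix without x and the
matrix without y lift; lifts are unique up to scaling (`exists_scaling`), so the two can be glued.

That the glued matrix is dyadic (`isPMatrix_of_isPMatrixOff`) comes down, by pivoting, to 2 × 2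
determinants in columns x and y. Pivots shorten a chain of rows joining the two rows until the ratio
of the two determinant terms is seen to be ±2^k with |k| ≤ 3. Confinement fixes the residue of this
ratio, and in that range the residue determines the ratio (`Level.fundamental`).

Disconnected supports and rows or columns with at most one nonzero entry reduce directly. What
remains is a cycle: one of length four is a 2 × 2 matrix, and a longer one acquires a vertex of
degree three after one pivot. -/

namespace PartialField

/-! ### Matrices over a partial field: scaling, pivoting and minors -/

section General

variable {R : Type*} [CommRing R] {P : PartialField R}

theorem Mem.zero : P.Mem 0 := Or.inl rfl

theorem Mem.of_unit {u : Rˣ} (hu : u ∈ P.G) : P.Mem (u : R) := Or.inr ⟨u, hu, rfl⟩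

theorem Mem.one : P.Mem 1 := Or.inr ⟨1, P.G.one_mem, rfl⟩

theorem Mem.mul {a b : R} (ha : P.Mem a) (hb : P.Mem b) : P.Mem (a * b) := by
  rcases ha with rfl | ⟨u, hu, rfl⟩
  · simpa using Mem.zero
  rcases hb with rfl | ⟨v, hv, rfl⟩
  · simpa using Mem.zero
  exact Or.inr ⟨u * v, P.G.mul_mem hu hv, by simp⟩

theorem Mem.neg {a : R} (ha : P.Mem a) : P.Mem (-a) := by
  rcases ha with rfl | ⟨u, hu, rfl⟩
  · simpa using Mem.zero
  exact Or.inr ⟨-1 * u, P.G.mul_mem P.neg_one_mem hu, by simp⟩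

theorem Mem.neg_one_pow_mul {a : R} (n : ℕ) (ha : P.Mem a) : P.Mem ((-1) ^ n * a) := by
  rcases neg_one_pow_eq_or R n with h | h <;> rw [h]
  · simpa using ha
  · simpa using ha.neg

theorem Mem.prod {ι : Type*} (s : Finset ι) (f : ι → R) (h : ∀ i ∈ s, P.Mem (f i)) :
    P.Mem (∏ i ∈ s, f i) :=
  Finset.prod_induction f P.Mem (fun _ _ => Mem.mul) Mem.one h

theorem Mem.exists_unit {a : R} (ha : P.Mem a) (h0 : a ≠ 0) : ∃ u ∈ P.G, (u : R) = a :=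
  ha.resolve_left h0

/-- A repeated row or column makes the determinant zero, so selections need not be injective. -/
theorem IsPMatrix.det_mem {X Y : Type} {A : Matrix X Y R} (hA : P.IsPMatrix A) {k : ℕ}
    (f : Fin k → X) (g : Fin k → Y) : P.Mem (A.submatrix f g).det := by
  by_cases hf : Function.Injective f
  · by_cases hg : Function.Injective g
    · exact hA k ⟨f, hf⟩ ⟨g, hg⟩
    · obtain ⟨a, b, hab, hne⟩ := Function.not_injective_iff.1 hg
      rw [Matrix.det_zero_of_column_eq hne (fun i => by simp [hab])]
      exact Mem.zero
  · obtain ⟨a, b, hab, hne⟩ := Function.not_injective_iff.1 hf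
    rw [Matrix.det_zero_of_row_eq hne (by ext j; simp [hab])]
    exact Mem.zero

theorem IsPMatrix.apply_mem {X Y : Type} {A : Matrix X Y R} (hA : P.IsPMatrix A) (i : X) (j : Y) :
    P.Mem (A i j) := by
  simpa using hA.det_mem (k := 1) (fun _ => i) (fun _ => j)

theorem IsPMatrix.det_two_mem {X Y : Type} {A : Matrix X Y R} (hA : P.IsPMatrix A)
    (r s : X) (x y : Y) : P.Mem (A r x * A s y - A r y * A s x) := by
  have h := hA.det_mem (k := 2) ![r, s] ![x, y]
  rw [Matrix.det_fin_two] at h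
  exact h

theorem IsPMatrix.submatrix {X Y X₁ Y₁ : Type} {A : Matrix X Y R} (hA : P.IsPMatrix A)
    (f : X₁ → X) (g : Y₁ → Y) : P.IsPMatrix (A.submatrix f g) := by
  intro k f' g'
  rw [Matrix.submatrix_submatrix]
  exact hA.det_mem _ _

theorem IsPMatrix.transpose {X Y : Type} {A : Matrix X Y R} (hA : P.IsPMatrix A) :
    P.IsPMatrix A.transpose := by
  intro k f g
  rw [← Matrix.det_transpose, Matrix.transpose_submatrix, Matrix.transpose_transpose]
  exact hA.det_mem _ _

theorem IsPMatrix.scale {X Y : Type} {A : Matrix X Y R} (hA : P.IsPMatrix A)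
    (s : X → R) (t : Y → R) (hs : ∀ i, P.Mem (s i)) (ht : ∀ j, P.Mem (t j)) :
    P.IsPMatrix (Matrix.of fun i j => s i * A i j * t j) := by
  intro k f g
  have h1 : (Matrix.of fun i j => s i * A i j * t j).submatrix f g =
      Matrix.of fun i j => t (g j) *
        (Matrix.of fun i j => s (f i) * (A.submatrix f g) i j : Matrix (Fin k) (Fin k) R) i j := by
    ext i j; simp [mul_comm]
  rw [h1, Matrix.det_mul_row, Matrix.det_mul_column]
  exact (Mem.prod _ _ fun _ _ => ht _).mul ((Mem.prod _ _ fun _ _ => hs _).mul (hA.det_mem _ _))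

theorem scaleRow_eq {X Y : Type} (A : Matrix X Y R) (x : X) (u : Rˣ) [DecidableEq X] :
    scaleRow A x u = Matrix.of fun i j => (if i = x then (u : R) else 1) * A i j * 1 := by
  ext i j
  by_cases h : i = x <;> simp [scaleRow, h]

theorem scaleCol_eq {X Y : Type} (A : Matrix X Y R) (y : Y) (u : Rˣ) [DecidableEq Y] :
    scaleCol A y u = Matrix.of fun i j => 1 * A i j * (if j = y then (u : R) else 1) := by
  ext i j
  by_cases h : j = y <;> simp [scaleCol, h, mul_comm]

theorem IsPMatrix.scaleRow {X Y : Type} {A : Matrix X Y R} (hA : P.IsPMatrix A) (x : X) {u : Rˣ}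
    (hu : u ∈ P.G) : P.IsPMatrix (scaleRow A x u) := by
  classical
  rw [scaleRow_eq]
  refine hA.scale (fun i => if i = x then (u : R) else 1) (fun _ => 1) (fun i => ?_)
    (fun _ => Mem.one)
  split_ifs
  exacts [Mem.of_unit hu, Mem.one]

theorem IsPMatrix.scaleCol {X Y : Type} {A : Matrix X Y R} (hA : P.IsPMatrix A) (y : Y) {u : Rˣ}
    (hu : u ∈ P.G) : P.IsPMatrix (scaleCol A y u) := by
  classical
  rw [scaleCol_eq]
  refine hA.scale (fun _ => 1) (fun j => if j = y then (u : R) else 1) (fun _ => Mem.one)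
    (fun j => ?_)
  split_ifs
  exacts [Mem.of_unit hu, Mem.one]

section Pivot

variable {X Y : Type} (A : Matrix X Y R) (x : X) (y : Y) (u : Rˣ)

@[simp] theorem pivot_self : pivot A x y u x y = ((u⁻¹ : Rˣ) : R) := by simp [pivot]

theorem pivot_row {j : Y} (hj : j ≠ y) : pivot A x y u x j = ((u⁻¹ : Rˣ) : R) * A x j := by
  simp [pivot, hj]

theorem pivot_col {i : X} (hi : i ≠ x) : pivot A x y u i y = -(((u⁻¹ : Rˣ) : R) * A i y) := by
  simp [pivot, hi]

theorem pivot_off {i : X} {j : Y} (hi : i ≠ x) (hj : j ≠ y) :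
    pivot A x y u i j = A i j - ((u⁻¹ : Rˣ) : R) * A i y * A x j := by
  simp [pivot, hi, hj]

variable {A x y u}

theorem pivot_pivot (h : A x y = (u : R)) : pivot (pivot A x y u) x y u⁻¹ = A := by
  ext i j
  by_cases hi : i = x <;> by_cases hj : j = y
  · subst hi hj; simp [h]
  · subst hi; rw [pivot_row _ _ _ _ hj, pivot_row _ _ _ _ hj]; simp
  · subst hj; rw [pivot_col _ _ _ _ hi, pivot_col _ _ _ _ hi]; simp
  · rw [pivot_off _ _ _ _ hi hj, pivot_off _ _ _ _ hi hj, pivot_row _ _ _ _ hj,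
      pivot_col _ _ _ _ hi]
    simp
    ring

theorem pivot_of_col_eq_zero {i : X} {j : Y} (hi : i ≠ x) (h : A i y = 0) :
    pivot A x y u i j = A i j := by
  by_cases hj : j = y
  · subst hj; rw [pivot_col _ _ _ _ hi, h]; simp
  · rw [pivot_off _ _ _ _ hi hj, h]; simp

theorem pivot_of_row_eq_zero {i : X} {j : Y} (hj : j ≠ y) (h : A x j = 0) :
    pivot A x y u i j = A i j := by
  by_cases hi : i = x
  · subst hi; rw [pivot_row _ _ _ _ hj, h]; simp
  · rw [pivot_off _ _ _ _ hi hj, h]; simp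

/-- The Schur complement formula: a subdeterminant through a pivot entry. -/
theorem det_submatrix_eq_pivot {k : ℕ} {f : Fin (k + 1) → X} {g : Fin (k + 1) → Y}
    (hf : Function.Injective f) (hg : Function.Injective g) (q p : Fin (k + 1))
    (h : A (f q) (g p) = (u : R)) :
    (A.submatrix f g).det = (-1) ^ (q + p : ℕ) * (u : R) *
      ((pivot A (f q) (g p) u).submatrix (f ∘ q.succAbove) (g ∘ p.succAbove)).det := by
  -- Row operations with row `q` clear column `p`; the remaining cofactor is a subdeterminant of the
  -- pivot.
  let B : Matrix (Fin (k + 1)) (Fin (k + 1)) R := Matrix.of fun i j =>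
    if i = q then A (f i) (g j) else A (f i) (g j) - ((u⁻¹ : Rˣ) : R) * A (f i) (g p) * A (f q) (g j)
  have hB : (A.submatrix f g).det = B.det := by
    refine Matrix.det_eq_of_forall_row_eq_smul_add_const
      (fun i => if i = q then 0 else ((u⁻¹ : Rˣ) : R) * A (f i) (g p)) q (by simp) ?_
    intro i j
    by_cases hi : i = q <;> simp [B, hi]
  rw [hB, Matrix.det_succ_column B p, Finset.sum_eq_single q]
  · congr 1
    · simp [B, h]
    · congr 1
      ext i j
      simp [B, Fin.succAbove_ne, pivot_off _ _ _ _ (hf.ne (Fin.succAbove_ne q i))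
        (hg.ne (Fin.succAbove_ne p j))]
  · intro i _ hi
    have : B i p = 0 := by
      simp [B, hi, h, mul_right_comm]
    simp [this]
  · simp

/-- Up to sign and a factor `u⁻¹`, a subdeterminant of the pivot is one of `A`: one size smaller if
both pivot lines are selected, the same size if exactly one is, one size larger if neither is. -/
theorem IsPMatrix.pivot (hA : P.IsPMatrix A) (hu : u ∈ P.G) (h : A x y = (u : R)) :
    P.IsPMatrix (PartialField.pivot A x y u) := by
  classical
  have hui : P.Mem ((u⁻¹ : Rˣ) : R) := Mem.of_unit (P.G.inv_mem hu)
  intro k f g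
  by_cases hx : x ∈ Set.range f <;> by_cases hy : y ∈ Set.range g
  · obtain ⟨q, rfl⟩ := hx
    obtain ⟨p, rfl⟩ := hy
    cases k with
    | zero => exact q.elim0
    | succ k =>
      rw [det_submatrix_eq_pivot (u := u⁻¹) f.injective g.injective q p (by simp),
        pivot_pivot h, mul_assoc]
      exact Mem.neg_one_pow_mul _ (hui.mul (hA.det_mem _ _))
  · obtain ⟨q, rfl⟩ := hx
    have hy' : ∀ j, g j ≠ y := fun j hj => hy ⟨j, hj⟩
    have := Matrix.det_eq_of_forall_row_eq_smul_add_const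
      (A := (PartialField.pivot A (f q) y u).submatrix f g)
      (B := Matrix.of fun i j => (if i = q then ((u⁻¹ : Rˣ) : R) else 1) * (A.submatrix f g) i j)
      (fun i => if i = q then 0 else -A (f i) y) q (by simp) (by
        intro i j
        by_cases hi : i = q
        · simp [hi, pivot_row _ _ _ _ (hy' j)]
        · simp [hi, pivot_off _ _ _ _ (f.injective.ne hi) (hy' j)]
          ring)
    rw [this, Matrix.det_mul_column]
    refine Mem.mul (Mem.prod _ _ fun i _ => ?_) (hA.det_mem _ _)
    split_ifs
    exacts [hui, Mem.one]
  · obtain ⟨p, rfl⟩ := hy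
    have hx' : ∀ i, f i ≠ x := fun j hj => hx ⟨j, hj⟩
    have := Matrix.det_eq_of_forall_row_eq_smul_add_const
      (A := ((PartialField.pivot A x (g p) u).submatrix f g).transpose)
      (B := (Matrix.of fun i j => (if j = p then -((u⁻¹ : Rˣ) : R) else 1) *
        (A.submatrix f g) i j).transpose)
      (fun j => if j = p then 0 else A x (g j)) p (by simp) (by
        intro j i
        by_cases hj : j = p
        · simp [hj, pivot_col _ _ _ _ (hx' i)]
        · simp [hj, pivot_off _ _ _ _ (hx' i) (g.injective.ne hj)]
          ring)
    rw [Matrix.det_transpose, Matrix.det_transpose] at this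
    rw [this, Matrix.det_mul_row]
    refine Mem.mul (Mem.prod _ _ fun i _ => ?_) (hA.det_mem _ _)
    split_ifs
    exacts [hui.neg, Mem.one]
  · have hf : Function.Injective (Fin.cons x f : Fin (k + 1) → X) :=
      Fin.cons_injective_iff.2 ⟨hx, f.injective⟩
    have hg : Function.Injective (Fin.cons y g : Fin (k + 1) → Y) :=
      Fin.cons_injective_iff.2 ⟨hy, g.injective⟩
    have key := det_submatrix_eq_pivot (A := A) (u := u) hf hg 0 0 (by simpa using h)
    have e : ((PartialField.pivot A x y u).submatrix f g).det =
        ((u⁻¹ : Rˣ) : R) * (A.submatrix (Fin.cons x f : Fin (k + 1) → X)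
          (Fin.cons y g : Fin (k + 1) → Y)).det := by
      rw [key]
      simp
    rw [e]
    exact hui.mul (hA.det_mem _ _)

theorem pivot_submatrix_id {Y₁ : Type} {g : Y₁ → Y} (hg : Function.Injective g) (c : Y₁) :
    (pivot A x (g c) u).submatrix id g = pivot (A.submatrix id g) x c u := by
  ext i j
  by_cases hi : i = x <;> by_cases hj : j = c <;>
    simp [pivot, hi, hj, hg.eq_iff]

theorem pivot_submatrix {X₁ Y₁ : Type} {f : X₁ → X} {g : Y₁ → Y} (hf : Function.Injective f)
    (hg : Function.Injective g) (r : X₁) (c : Y₁) :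
    (pivot A (f r) (g c) u).submatrix f g = pivot (A.submatrix f g) r c u := by
  ext i j
  by_cases hi : i = r <;> by_cases hj : j = c <;>
    simp [pivot, hi, hj, hg.eq_iff, hf.eq_iff]

theorem transpose_pivot [DecidableEq X] [DecidableEq Y] : (pivot A x y u).transpose =
    scaleRow (scaleCol (pivot A.transpose y x u) x (-1)) y (-1) := by
  ext j i
  by_cases hi : i = x <;> by_cases hj : j = y <;>
    simp [pivot, scaleRow, scaleCol, hi, hj]
  ring

theorem pivot_map {S : Type*} [CommRing S] (φ : R →+* S) :
    (pivot A x y u).map φ = pivot (A.map φ) x y (Units.map φ.toMonoidHom u) := by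
  ext i j
  by_cases hi : i = x <;> by_cases hj : j = y <;>
    simp [pivot, hi, hj]

end Pivot

/-- A class of matrices that is closed under pivoting and has all entries in `P` consists of
`P`-matrices. -/
theorem isPMatrix_of_pivot_closed {X Y : Type} (C : Matrix X Y R → Prop)
    (hmem : ∀ A, C A → ∀ i j, P.Mem (A i j))
    (hpiv : ∀ A, C A → ∀ i j u, u ∈ P.G → A i j = (u : R) → C (pivot A i j u))
    {A : Matrix X Y R} (hA : C A) : P.IsPMatrix A := by
  intro k
  induction k generalizing A with
  | zero => intro f g; simpa using Mem.one
  | succ k ih =>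
    intro f g
    by_cases h0 : ∀ i, A (f i) (g 0) = 0
    · rw [Matrix.det_eq_zero_of_column_eq_zero 0 (by simpa using h0)]
      exact Mem.zero
    · push Not at h0
      obtain ⟨q, hq⟩ := h0
      obtain ⟨u, hu, huq⟩ := (hmem A hA _ _).exists_unit hq
      rw [det_submatrix_eq_pivot f.injective g.injective q 0 huq.symm, mul_assoc]
      exact Mem.neg_one_pow_mul _ ((Mem.of_unit hu).mul
        (ih (hpiv A hA _ _ u hu huq.symm) (q.succAboveEmb.trans f)
          ((0 : Fin (k + 1)).succAboveEmb.trans g)))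

theorem MinorOf.trans {X Y X₁ Y₁ X₂ Y₂ : Type} {A : Matrix X Y R} {B : Matrix X₁ Y₁ R}
    {C : Matrix X₂ Y₂ R} (h₁ : P.MinorOf A B) (h₂ : P.MinorOf B C) : P.MinorOf A C := by
  induction h₂ with
  | refl => exact h₁
  | scaleRow _ x u hu ih => exact ih.scaleRow x u hu
  | scaleCol _ x u hu ih => exact ih.scaleCol x u hu
  | submatrix _ f g ih => exact ih.submatrix f g
  | pivot _ x y u hu hxy ih => exact ih.pivot x y u hu hxy

theorem MinorOf.transpose {X Y X₁ Y₁ : Type} {A : Matrix X Y R} {B : Matrix X₁ Y₁ R}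
    (h : P.MinorOf A B) : P.MinorOf A.transpose B.transpose := by
  classical
  induction h with
  | refl => exact .refl
  | @scaleRow _ _ B _ x u hu ih =>
    have e : (PartialField.scaleRow B x u).transpose =
        PartialField.scaleCol B.transpose x u := by
      ext i j
      simp [PartialField.scaleRow, PartialField.scaleCol]
    rw [e]
    exact ih.scaleCol x u hu
  | @scaleCol _ _ B _ x u hu ih =>
    have e : (PartialField.scaleCol B x u).transpose =
        PartialField.scaleRow B.transpose x u := by
      ext i j
      simp [PartialField.scaleRow, PartialField.scaleCol]
    rw [e]
    exact ih.scaleRow x u hu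
  | submatrix _ f g ih => exact ih.submatrix g f
  | pivot _ x y u hu hxy ih =>
    rw [transpose_pivot]
    exact ((ih.pivot y x u hu hxy).scaleCol x (-1) P.neg_one_mem).scaleRow y (-1) P.neg_one_mem

theorem crossRatios_subset_of_minorOf {X Y X₁ Y₁ : Type} {A : Matrix X Y R} {B : Matrix X₁ Y₁ R}
    (h : P.MinorOf A B) : P.crossRatios B ⊆ P.crossRatios A := fun _ hp => h.trans hp

theorem crossRatios_transpose_subset {X Y : Type} (A : Matrix X Y R) :
    P.crossRatios A.transpose ⊆ P.crossRatios A := by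
  intro p hp
  have h : P.MinorOf A !![1, 1; p, 1].transpose := MinorOf.transpose hp
  -- Transposing moves `p` to the upper right; reversing both rows and columns brings it back.
  have h' := h.submatrix (Equiv.swap (0 : Fin 2) 1).toEmbedding
    (Equiv.swap (0 : Fin 2) 1).toEmbedding
  have e : (!![1, 1; p, 1] : Matrix (Fin 2) (Fin 2) R).transpose.submatrix
      (Equiv.swap (0 : Fin 2) 1).toEmbedding (Equiv.swap (0 : Fin 2) 1).toEmbedding =
      !![1, 1; p, 1] := by
    ext i j
    fin_cases i <;> fin_cases j <;> simp
  rwa [e] at h'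

end General

end PartialField

/-! ### Arithmetic of the dyadic partial field and of its residues modulo 11 -/

/-- The ring `ℤ[1/2]`. -/
def DyadicRing : Type := Localization.Away (2 : ℤ)

namespace DyadicRing

open PartialField

noncomputable instance : CommRing DyadicRing :=
  inferInstanceAs (CommRing (Localization.Away (2 : ℤ)))

noncomputable instance : Algebra ℤ DyadicRing :=
  inferInstanceAs (Algebra ℤ (Localization.Away (2 : ℤ)))

instance : IsLocalization.Away (2 : ℤ) DyadicRing :=
  inferInstanceAs (IsLocalization.Away (2 : ℤ) (Localization.Away (2 : ℤ)))

instance : IsDomain DyadicRing :=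
  IsLocalization.isDomain_localization (powers_le_nonZeroDivisors_of_noZeroDivisors two_ne_zero)

/-- The dyadic partial field, as a partial field on `DyadicRing`. -/
noncomputable def dyadicField : PartialField DyadicRing := PartialField.dyadic

/-- The unit `2` of `ℤ[1/2]`. -/
noncomputable def two : DyadicRingˣ :=
  (IsLocalization.Away.algebraMap_isUnit (S := DyadicRing) (2 : ℤ)).unit

@[simp] theorem coe_two : (two : DyadicRing) = 2 := by
  simp [two]

theorem dyadicField_G : dyadicField.G = Subgroup.closure {-1, two} := rfl

theorem intCast_injective : Function.Injective (fun n : ℤ => (n : DyadicRing)) := by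
  have h := IsLocalization.injective (DyadicRing)
    (powers_le_nonZeroDivisors_of_noZeroDivisors (two_ne_zero (α := ℤ)))
  intro a b hab
  apply h
  simpa using hab

theorem isUnit_two_zmod : IsUnit (Int.castRingHom (ZMod 11) 2) := by
  have : ((2 : ZMod 11)) ≠ 0 := by decide
  simpa using this

/-- Reduction modulo `11`. -/
noncomputable def toZMod : DyadicRing →+* ZMod 11 :=
  IsLocalization.Away.lift (2 : ℤ) isUnit_two_zmod

@[simp] theorem toZMod_two : toZMod 2 = 2 := map_ofNat _ _

/-- The element `1/2`. -/
noncomputable abbrev half : DyadicRing := ((two⁻¹ : DyadicRingˣ) : DyadicRing)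

theorem two_mul_half : (2 : DyadicRing) * half = 1 := by
  rw [← coe_two, Units.mul_inv]

@[simp] theorem toZMod_half : toZMod half = 6 := by
  have h := congrArg toZMod two_mul_half
  rw [map_mul, toZMod_two, map_one] at h
  revert h
  generalize toZMod half = a
  revert a
  decide

theorem two_mem : two ∈ dyadicField.G := by
  rw [dyadicField_G]; exact Subgroup.subset_closure (by simp)

theorem mem_G {u : DyadicRingˣ} (hu : u ∈ dyadicField.G) :
    ∃ k : ℤ, (u : DyadicRing) = ((two ^ k : DyadicRingˣ) : DyadicRing) ∨
      (u : DyadicRing) = -((two ^ k : DyadicRingˣ) : DyadicRing) := by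
  rw [dyadicField_G] at hu
  obtain ⟨m, k, rfl⟩ := Subgroup.mem_closure_pair.1 hu
  refine ⟨k, ?_⟩
  rcases Int.even_or_odd m with h | h
  · left; rw [h.neg_one_zpow]; simp
  · right; rw [h.neg_one_zpow]; simp

theorem toZMod_unit_ne_zero (u : DyadicRingˣ) : toZMod u ≠ 0 :=
  (u.isUnit.map toZMod).ne_zero

/-- Nonzero members are units, and units reduce to units. This is what makes zero patterns and bases
survive reduction. -/
theorem toZMod_eq_zero {p : DyadicRing} (hp : dyadicField.Mem p) : toZMod p = 0 ↔ p = 0 := by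
  constructor
  · intro h
    by_contra h0
    obtain ⟨u, -, rfl⟩ := hp.exists_unit h0
    exact toZMod_unit_ne_zero u h
  · rintro rfl; simp

/-- `p` is `± 2 ^ k` with `|k| ≤ n`. -/
def Level (n : ℕ) (p : DyadicRing) : Prop :=
  ∃ k : ℤ, |k| ≤ n ∧ (p = ((two ^ k : DyadicRingˣ) : DyadicRing) ∨
    p = -((two ^ k : DyadicRingˣ) : DyadicRing))

theorem Level.mul {m n : ℕ} {p q : DyadicRing} (hp : Level m p) (hq : Level n q) :
    Level (m + n) (p * q) := by
  obtain ⟨k, hk, hp⟩ := hp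
  obtain ⟨l, hl, hq⟩ := hq
  refine ⟨k + l, ?_, ?_⟩
  · push_cast; exact (abs_add_le k l).trans (add_le_add hk hl)
  · rw [zpow_add]
    rcases hp with rfl | rfl <;> rcases hq with rfl | rfl <;> simp

theorem Level.neg {n : ℕ} {p : DyadicRing} (hp : Level n p) : Level n (-p) := by
  obtain ⟨k, hk, hp⟩ := hp
  refine ⟨k, hk, ?_⟩
  rcases hp with rfl | rfl <;> simp

theorem Level.mono {m n : ℕ} (h : m ≤ n) {p : DyadicRing} (hp : Level m p) : Level n p := by
  obtain ⟨k, hk, hp⟩ := hp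
  exact ⟨k, hk.trans (by exact_mod_cast h), hp⟩

/-- The fundamental elements of the dyadic partial field, other than `0`. -/
def Fundamental (p : DyadicRing) : Prop := p = 1 ∨ p = -1 ∨ p = 2 ∨ p = half

theorem Fundamental.level {p : DyadicRing} (hp : Fundamental p) : Level 1 p := by
  rcases hp with rfl | rfl | rfl | rfl
  · exact ⟨0, by simp, by simp⟩
  · exact ⟨0, by simp, by simp⟩
  · exact ⟨1, by simp, by simp⟩
  · exact ⟨-1, by simp, by simp⟩

theorem Fundamental.sub_one_mem {p : DyadicRing} (hp : Fundamental p) : dyadicField.Mem (p - 1) := by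
  rcases hp with rfl | rfl | rfl | rfl
  · simpa using Mem.zero
  · have : (-1 - 1 : DyadicRing) = -((two : DyadicRingˣ) : DyadicRing) := by
      rw [coe_two]; ring
    rw [this]; exact (Mem.of_unit two_mem).neg
  · have : (2 - 1 : DyadicRing) = 1 := by ring
    rw [this]; exact Mem.one
  · have : half - 1 = -half := by linear_combination two_mul_half
    rw [this]; exact (Mem.of_unit (dyadicField.G.inv_mem two_mem)).neg

theorem Fundamental.toZMod_mem {p : DyadicRing} (hp : Fundamental p) :
    toZMod p ∈ ({2, 6, 10} ∪ {0, 1} : Set (ZMod 11)) := by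
  rcases hp with rfl | rfl | rfl | rfl
  · simp
  · have : (-1 : ZMod 11) = 10 := by decide
    simp [this]
  · simp
  · rw [toZMod_half]; simp

theorem Fundamental.eq_of_toZMod_eq {p q : DyadicRing} (hp : Fundamental p) (hq : Fundamental q)
    (h : toZMod p = toZMod q) : p = q := by
  rcases hp with rfl | rfl | rfl | rfl <;> rcases hq with rfl | rfl | rfl | rfl <;>
    first
    | rfl
    | (simp only [toZMod_half, toZMod_two, map_one, map_neg] at h
       exact absurd h (by decide))

/-- By parity exactly two of the three powers equal 1, and the third is then 2. The three outcomes
say that `e * 2 ^ (a - c)` is -1, 2 or 1/2. -/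
theorem signed_two_pow_add {e d : ℤ} {a b c : ℕ} (he : e = 1 ∨ e = -1) (hd : d = 1 ∨ d = -1)
    (h0 : a = 0 ∨ b = 0 ∨ c = 0) (h : e * 2 ^ a + d * 2 ^ b = 2 ^ c) :
    (a = c ∧ e = -1) ∨ (a = c + 1 ∧ e = 1) ∨ (c = a + 1 ∧ e = 1) := by
  have hpow : ∀ n : ℕ, (1 : ℤ) = 2 ^ n → n = 0 := by
    intro n hn
    cases n with
    | zero => rfl
    | succ n => rw [pow_succ] at hn; omega
  have hpos : ∀ n : ℕ, (0 : ℤ) < 2 ^ n := fun n => by positivity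
  have h1 := hpos a
  have h2 := hpos b
  have h3 := hpos c
  rcases a with _ | a <;> rcases b with _ | b <;> rcases c with _ | c <;>
    simp only [pow_zero, pow_succ] at * <;>
    rcases he with rfl | rfl <;> rcases hd with rfl | rfl <;>
    try omega
  all_goals
    first
    | simp; done
    | have := hpow _ (show (1 : ℤ) = 2 ^ _ by linarith)
      omega

/-- Writing `p` and `1 - p` as signed powers of 2 turns `p + (1 - p) = 1` into an integer equation
between three powers of 2, once denominators are cleared. -/
theorem fundamental_of_one_sub_mem {p : DyadicRing} (hp : dyadicField.Mem p) (h0 : p ≠ 0)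
    (h1 : dyadicField.Mem (1 - p)) : Fundamental p := by
  by_cases h2 : 1 - p = 0
  · left; linear_combination -h2
  have sgn : ∀ q : DyadicRing, dyadicField.Mem q → q ≠ 0 →
      ∃ (k e : ℤ), (e = 1 ∨ e = -1) ∧ q = e * ((two ^ k : DyadicRingˣ) : DyadicRing) := by
    intro q hq hq0
    obtain ⟨u, hu, rfl⟩ := hq.exists_unit hq0
    obtain ⟨k, h | h⟩ := mem_G hu
    · exact ⟨k, 1, by simp, by simp [h]⟩
    · exact ⟨k, -1, by simp, by simp [h]⟩
  obtain ⟨k, e, he, hk⟩ := sgn p hp h0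
  obtain ⟨l, d, hd, hl⟩ := sgn _ h1 h2
  -- The least `c` clearing both denominators is max(0, -k, -l); being least, it makes one of the
  -- three exponents zero.
  obtain ⟨a, b, c, hac, hbc, hz⟩ : ∃ a b c : ℕ, (a : ℤ) = k + c ∧ (b : ℤ) = l + c ∧
      (a = 0 ∨ b = 0 ∨ c = 0) :=
    ⟨(k + max 0 (max (-k) (-l))).toNat, (l + max 0 (max (-k) (-l))).toNat,
      (max 0 (max (-k) (-l))).toNat, by omega, by omega, by omega⟩
  have pw : ∀ (j : ℤ) (n m : ℕ), (n : ℤ) = j + m →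
      ((two ^ j : DyadicRingˣ) : DyadicRing) * 2 ^ m = 2 ^ n := by
    intro j n m h
    have : (two ^ n : DyadicRingˣ) = two ^ j * two ^ m := by
      rw [← zpow_natCast, ← zpow_natCast, ← zpow_add, h]
    have := congrArg (fun u : DyadicRingˣ => (u : DyadicRing)) this
    simpa using this.symm
  have hsum : e * 2 ^ a + d * 2 ^ b = 2 ^ c := by
    apply intCast_injective
    push_cast
    rw [← pw k a c hac, ← pw l b c hbc]
    linear_combination (-2 ^ c : DyadicRing) * hl - (2 ^ c : DyadicRing) * hk
  rcases signed_two_pow_add he hd hz hsum with ⟨h, rfl⟩ | ⟨h, rfl⟩ | ⟨h, rfl⟩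
  · obtain rfl : k = 0 := by omega
    right; left; simpa using hk
  · obtain rfl : k = 1 := by omega
    right; right; left; simpa using hk
  · obtain rfl : k = -1 := by omega
    right; right; right; simpa using hk

/-- Among ±2^k with |k| ≤ 3, each of the residues 1, 2, 6, 10 occurs once, at 1, 2, 1/2, -1. The
bound 3 is sharp, since -2^4 reduces to 6. -/
theorem Level.fundamental {p : DyadicRing} (hp : Level 3 p)
    (h : toZMod p ∈ ({2, 6, 10} ∪ {0, 1} : Set (ZMod 11))) : Fundamental p := by
  obtain ⟨k, hk, hp⟩ := hp
  have h3 : |k| ≤ 3 := by exact_mod_cast hk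
  rw [abs_le] at h3
  obtain ⟨h3, h3'⟩ := h3
  have e2 : (two ^ (-1 : ℤ) : DyadicRingˣ) = two⁻¹ := by simp
  have z2 : (two ^ (-2 : ℤ) : DyadicRingˣ) = two⁻¹ * two⁻¹ := by
    rw [← e2, ← zpow_add]; rfl
  have z3 : (two ^ (-3 : ℤ) : DyadicRingˣ) = two⁻¹ * two⁻¹ * two⁻¹ := by
    rw [← e2, ← zpow_add, ← zpow_add]; rfl
  have y2 : (two ^ (2 : ℤ) : DyadicRingˣ) = two * two := by
    rw [← sq]; rfl
  have y3 : (two ^ (3 : ℤ) : DyadicRingˣ) = two * two * two := by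
    rw [← sq, ← pow_succ]; rfl
  interval_cases k <;> rcases hp with rfl | rfl <;>
    simp only [e2, z2, z3, y2, y3, zpow_zero, zpow_one, Units.val_mul, Units.val_one, coe_two,
      map_mul, map_neg, toZMod_half, toZMod_two, map_one, Set.mem_union, Set.mem_insert_iff,
      Set.mem_singleton_iff] at h ⊢ <;>
    first
    | exact absurd h (by decide)
    | simp [Fundamental]

/-- `a / b` has the form `± 2 ^ k` with `|k| ≤ n`. -/
def LevelRatio (n : ℕ) (a b : DyadicRing) : Prop := ∃ e, Level n e ∧ a = e * b

theorem LevelRatio.mul {m n : ℕ} {a b c d : DyadicRing} (h₁ : LevelRatio m a b)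
    (h₂ : LevelRatio n c d) : LevelRatio (m + n) (a * c) (b * d) := by
  obtain ⟨e, he, rfl⟩ := h₁
  obtain ⟨f, hf, rfl⟩ := h₂
  exact ⟨e * f, he.mul hf, by ring⟩

theorem LevelRatio.cancel {n : ℕ} {a b c : DyadicRing} (hc : c ≠ 0)
    (h : LevelRatio n (c * a) (c * b)) : LevelRatio n a b := by
  obtain ⟨e, he, h⟩ := h
  refine ⟨e, he, mul_left_cancel₀ hc ?_⟩
  rw [h]; ring

/-- After division by `b`, both `a / b` and `1 - a / b` are dyadic. In use, `a` and `b` are the two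
terms of a subdeterminant. -/
theorem exists_fundamental_ratio {a b : DyadicRing} (ha : dyadicField.Mem a) (hb : dyadicField.Mem b)
    (ha0 : a ≠ 0) (hb0 : b ≠ 0) (h : dyadicField.Mem (a - b)) : ∃ e, Fundamental e ∧ a = e * b := by
  obtain ⟨v, hv, rfl⟩ := hb.exists_unit hb0
  have hvi : dyadicField.Mem ((v⁻¹ : DyadicRingˣ) : DyadicRing) := Mem.of_unit (dyadicField.G.inv_mem hv)
  refine ⟨a * ((v⁻¹ : DyadicRingˣ) : DyadicRing), ?_, by simp⟩
  refine fundamental_of_one_sub_mem (ha.mul hvi) (mul_ne_zero ha0 (Units.ne_zero _)) ?_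
  have : 1 - a * ((v⁻¹ : DyadicRingˣ) : DyadicRing) =
      -((a - v) * ((v⁻¹ : DyadicRingˣ) : DyadicRing)) := by
    rw [sub_mul, Units.mul_inv]; ring
  rw [this]
  exact (h.mul hvi).neg

theorem levelRatio_one {a b : DyadicRing} (ha : dyadicField.Mem a) (hb : dyadicField.Mem b)
    (ha0 : a ≠ 0) (hb0 : b ≠ 0) (h : dyadicField.Mem (a - b)) : LevelRatio 1 a b := by
  obtain ⟨e, he, h⟩ := exists_fundamental_ratio ha hb ha0 hb0 h
  exact ⟨e, he.level, h⟩

/-- The residue `p` forces the ratio `e` to be fundamental, and then `(e - 1) * b` is dyadic. -/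
theorem LevelRatio.sub_mem {a b : DyadicRing} (hb : dyadicField.Mem b) (hb0 : b ≠ 0)
    (h : LevelRatio 3 a b) {p : ZMod 11} (hp : p ∈ ({2, 6, 10} ∪ {0, 1} : Set (ZMod 11)))
    (hpab : toZMod a = p * toZMod b) : dyadicField.Mem (a - b) := by
  obtain ⟨e, he, rfl⟩ := h
  have hb' : toZMod b ≠ 0 := fun h => hb0 ((toZMod_eq_zero hb).1 h)
  rw [map_mul] at hpab
  have : toZMod e = p := mul_right_cancel₀ hb' hpab
  have h2 : e * b - b = (e - 1) * b := by ring
  rw [h2]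
  exact (he.fundamental (this ▸ hp)).sub_one_mem.mul hb

/-- 2 is a primitive root modulo 11. -/
theorem exists_unit_toZMod_eq {a : ZMod 11} (ha : a ≠ 0) :
    ∃ u ∈ dyadicField.G, toZMod ((u : DyadicRingˣ) : DyadicRing) = a := by
  have : ∀ a : ZMod 11, a ≠ 0 → ∃ k : Fin 10, a = 2 ^ (k : ℕ) := by decide
  obtain ⟨k, rfl⟩ := this a ha
  exact ⟨two ^ (k : ℕ), dyadicField.G.pow_mem two_mem _, by simp⟩

/-- A lift of an element of `GF(11)` to the dyadic partial field. -/
theorem exists_mem_toZMod_eq (a : ZMod 11) : ∃ b, dyadicField.Mem b ∧ toZMod b = a := by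
  by_cases ha : a = 0
  · exact ⟨0, Mem.zero, by simp [ha]⟩
  · obtain ⟨u, hu, h⟩ := exists_unit_toZMod_eq ha
    exact ⟨u, Mem.of_unit hu, h⟩

theorem exists_fundamental_toZMod_eq {p : ZMod 11}
    (hp : p ∈ ({2, 6, 10} ∪ {0, 1} : Set (ZMod 11))) (h0 : p ≠ 0) :
    ∃ e, Fundamental e ∧ toZMod e = p := by
  simp only [Set.mem_union, Set.mem_insert_iff, Set.mem_singleton_iff] at hp
  rcases hp with (rfl | rfl | rfl) | rfl | rfl
  · exact ⟨2, by simp [Fundamental], toZMod_two⟩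
  · exact ⟨half, by simp [Fundamental], toZMod_half⟩
  · exact ⟨-1, by simp [Fundamental], by rw [map_neg, map_one]; decide⟩
  · exact absurd rfl h0
  · exact ⟨1, by simp [Fundamental], map_one _⟩

theorem Fundamental.mem {p : DyadicRing} (hp : Fundamental p) : dyadicField.Mem p := by
  rcases hp with rfl | rfl | rfl | rfl
  · exact Mem.one
  · exact Mem.one.neg
  · rw [← coe_two]; exact Mem.of_unit two_mem
  · exact Mem.of_unit (dyadicField.G.inv_mem two_mem)

end DyadicRing

/-! ### Cross ratios of a reduction -/

namespace DyadicRing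

open PartialField

/-- Each operation is mirrored upstairs: scalars lift because the dyadic units reach all nonzero
residues, and an entry over a nonzero pivot is itself a dyadic unit. -/
theorem exists_lift_of_minorOf {X Y X₁ Y₁ : Type} {A : Matrix X Y DyadicRing}
    (hA : dyadicField.IsPMatrix A) {B : Matrix X₁ Y₁ (ZMod 11)}
    (h : (ofField (ZMod 11)).MinorOf (A.map toZMod) B) :
    ∃ B' : Matrix X₁ Y₁ DyadicRing, dyadicField.IsPMatrix B' ∧ B'.map toZMod = B := by
  induction h with
  | refl => exact ⟨A, hA, rfl⟩
  | scaleRow _ x u _ ih =>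
    obtain ⟨B', hB', rfl⟩ := ih
    obtain ⟨v, hv, hvu⟩ := exists_unit_toZMod_eq u.ne_zero
    refine ⟨_, hB'.scaleRow x hv, ?_⟩
    ext i j
    by_cases hi : i = x <;> simp [scaleRow, hi, hvu]
  | scaleCol _ y u _ ih =>
    obtain ⟨B', hB', rfl⟩ := ih
    obtain ⟨v, hv, hvu⟩ := exists_unit_toZMod_eq u.ne_zero
    refine ⟨_, hB'.scaleCol y hv, ?_⟩
    ext i j
    by_cases hj : j = y <;> simp [scaleCol, hj, hvu]
  | submatrix _ f g ih =>
    obtain ⟨B', hB', rfl⟩ := ih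
    exact ⟨_, hB'.submatrix f g, rfl⟩
  | pivot _ x y u _ hxy ih =>
    obtain ⟨B', hB', rfl⟩ := ih
    have h0 : B' x y ≠ 0 := fun h => u.ne_zero (by rw [← hxy]; simp [h])
    obtain ⟨v, hv, hvu⟩ := (hB'.apply_mem x y).exists_unit h0
    refine ⟨_, hB'.pivot hv hvu.symm, ?_⟩
    rw [pivot_map]
    congr 1
    ext
    rw [← hxy]
    simp [hvu]

theorem exists_fundamental_of_isPMatrix {X Y : Type} {A : Matrix X Y DyadicRing}
    (hA : dyadicField.IsPMatrix A) {r s : X} {x y : Y} (h₁ : A r x ≠ 0) (h₂ : A r y ≠ 0)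
    (h₃ : A s x ≠ 0) (h₄ : A s y ≠ 0) :
    ∃ e, Fundamental e ∧ A r x * A s y = e * (A r y * A s x) :=
  exists_fundamental_ratio ((hA.apply_mem _ _).mul (hA.apply_mem _ _))
    ((hA.apply_mem _ _).mul (hA.apply_mem _ _)) (mul_ne_zero h₁ h₄) (mul_ne_zero h₂ h₃)
    (hA.det_two_mem r s x y)

/-- A 2 × 2 minor exhibiting `p ≠ 0` lifts to a dyadic matrix; the ratio of its two determinant
terms is fundamental and reduces to `p`. -/
theorem isConfined_map {X Y : Type} {A : Matrix X Y DyadicRing}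
    (hA : dyadicField.IsPMatrix A) :
    (ofField (ZMod 11)).IsConfined {2, 6, 10} (A.map toZMod) := by
  intro p hp
  obtain ⟨B, hB, h⟩ := exists_lift_of_minorOf hA hp
  have e00 : toZMod (B 0 0) = 1 := congrFun (congrFun h 0) 0
  have e01 : toZMod (B 0 1) = 1 := congrFun (congrFun h 0) 1
  have e10 : toZMod (B 1 0) = p := congrFun (congrFun h 1) 0
  have e11 : toZMod (B 1 1) = 1 := congrFun (congrFun h 1) 1
  have ne : ∀ {b : DyadicRing}, toZMod b ≠ 0 → b ≠ 0 := by
    rintro _ h rfl; exact h (map_zero _)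
  by_cases hp0 : p = 0
  · simp [hp0]
  obtain ⟨e, he, h⟩ := exists_fundamental_of_isPMatrix hB (r := 1) (s := 0) (x := 0) (y := 1)
    (ne (by rwa [e10])) (ne (by rw [e11]; exact one_ne_zero)) (ne (by rw [e00]; exact one_ne_zero))
    (ne (by rw [e01]; exact one_ne_zero))
  have := congrArg toZMod h
  simp only [map_mul, e00, e01, e10, e11, mul_one] at this
  rw [this]
  exact he.toZMod_mem

/-- Cross ratios of `2 × 2` submatrices without zero entries. -/
theorem exists_crossRatio {X Y : Type} {A : Matrix X Y (ZMod 11)} {F : Set (ZMod 11)}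
    (hA : (ofField (ZMod 11)).IsConfined F A) {r s : X} {x y : Y} (h₁ : A r x ≠ 0)
    (h₂ : A r y ≠ 0) (h₃ : A s x ≠ 0) (h₄ : A s y ≠ 0) :
    ∃ p ∈ F ∪ {0, 1}, A r x * A s y = p * (A r y * A s x) := by
  by_cases hrs : r = s
  · subst hrs; exact ⟨1, by simp, by ring⟩
  by_cases hxy : x = y
  · subst hxy; exact ⟨1, by simp, by ring⟩
  refine ⟨A r x * A s y * (A r y * A s x)⁻¹, hA ?_, by
    rw [inv_mul_cancel_right₀ (mul_ne_zero h₂ h₃)]⟩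
  -- With row `s` on top, scaling that row to (1, 1) and the lower right entry to 1 leaves the
  -- required ratio in the lower left.
  have hf : Function.Injective ![s, r] := by
    intro a b; fin_cases a <;> fin_cases b <;> simp [hrs, Ne.symm hrs]
  have hg : Function.Injective ![x, y] := by
    intro a b; fin_cases a <;> fin_cases b <;> simp [hxy, Ne.symm hxy]
  have m₁ := (MinorOf.refl (P := ofField (ZMod 11)) (A' := A)).submatrix ⟨_, hf⟩ ⟨_, hg⟩
  have m₂ := m₁.scaleCol 0 (Units.mk0 _ h₃)⁻¹ (Subgroup.mem_top _)
  have m₃ := m₂.scaleCol 1 (Units.mk0 _ h₄)⁻¹ (Subgroup.mem_top _)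
  have m₄ := m₃.scaleRow 1 (Units.mk0 _ h₂)⁻¹ (Subgroup.mem_top _)
  have m₅ := m₄.scaleRow 1 (Units.mk0 _ h₄) (Subgroup.mem_top _)
  change (ofField (ZMod 11)).MinorOf A _
  convert m₅ using 1
  ext i j
  fin_cases i <;> fin_cases j <;> simp [scaleRow, scaleCol, h₃, h₄]
  all_goals field_simp

end DyadicRing

/-! ### Chains of rows and their shortening by pivots -/

namespace PartialField

section Chains

variable {R : Type*} [CommRing R] {X Y : Type}

/-- `RowChain W A n r s`: there is a chain of `n` links from row `r` to row `s`, where a link joins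
two rows that are both nonzero in some column belonging to `W`. -/
inductive RowChain (W : Y → Prop) (A : Matrix X Y R) : ℕ → X → X → Prop
  | refl (r : X) : RowChain W A 0 r r
  | step {n : ℕ} {r r' s : X} (c : Y) (hc : W c) (h : A r c ≠ 0) (h' : A r' c ≠ 0)
      (hs : RowChain W A n r' s) : RowChain W A (n + 1) r s

variable {W : Y → Prop} {A : Matrix X Y R}

/-- The pivot alters only rows that are nonzero in column `c₂`, and `H` excludes these from the
chain. -/
theorem RowChain.pivot_of_forall {r₁ : X} {c₂ : Y} {u : Rˣ} (h₁ : A r₁ c₂ ≠ 0) {n : ℕ} {t s : X}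
    (h : RowChain W A n t s) (H : ∀ m ≤ n, ∀ t', RowChain W A m t' s → A t' c₂ = 0) :
    RowChain W (pivot A r₁ c₂ u) n t s := by
  induction h with
  | refl r => exact .refl r
  | @step n r r' s c hc h h' hs ih =>
    have ne : ∀ m ≤ n + 1, ∀ t', RowChain W A m t' s → t' ≠ r₁ := by
      rintro m hm _ ht rfl
      exact h₁ (H m hm _ ht)
    refine .step c hc ?_ ?_ (ih fun m hm => H m (by omega))
    · rw [pivot_of_col_eq_zero (ne _ le_rfl _ (.step c hc h h' hs)) (H _ le_rfl _ (.step c hc h h' hs))]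
      exact h
    · rw [pivot_of_col_eq_zero (ne _ (by omega) _ hs) (H _ (by omega) _ hs)]
      exact h'

/-- A shortest chain of at least two links can be shortened by a pivot on its third edge. -/
theorem RowChain.exists_shorten [IsDomain R] {n : ℕ} {r s : X} (h : RowChain W A (n + 2) r s)
    (hmin : ∀ m < n + 2, ¬ RowChain W A m r s) :
    ∃ r₁ c₁ c₂, W c₁ ∧ W c₂ ∧ A r c₁ ≠ 0 ∧ A r₁ c₁ ≠ 0 ∧ A r₁ c₂ ≠ 0 ∧ A r c₂ = 0 ∧
      (n = 0 → A s c₂ ≠ 0 ∧ A s c₁ = 0) ∧ (n ≠ 0 → A s c₂ = 0) ∧ RowChain W A (n + 1) r₁ s ∧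
      ∀ u : Rˣ, RowChain W (pivot A r₁ c₂ u) (n + 1) r s := by
  obtain _ | ⟨c₁, hc₁, h₁, h₁', h⟩ := h
  rename_i r₁
  obtain _ | ⟨c₂, hc₂, h₂, h₂', h⟩ := id h
  rename_i hr₁ r₂
  -- Here and below, a nonzero entry off the chain would be a shortcut contradicting minimality.
  have hr2 : A r c₂ = 0 := by
    by_contra h0
    exact hmin (n + 1) (by omega) (.step c₂ hc₂ h0 h₂' h)
  have h21 : A r₂ c₁ = 0 := by
    by_contra h0
    exact hmin (n + 1) (by omega) (.step c₁ hc₁ h₁ h0 h)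
  have hc : c₁ ≠ c₂ := by rintro rfl; exact h₁ hr2
  have hrr : r ≠ r₁ := by rintro rfl; exact h₂ hr2
  have hr₂₁ : r₂ ≠ r₁ := by rintro rfl; exact h₁' h21
  refine ⟨r₁, c₁, c₂, hc₁, hc₂, h₁, h₁', h₂, hr2, ?_, ?_, hr₁, ?_⟩
  · rintro rfl
    cases h
    exact ⟨h₂', h21⟩
  · intro hn
    by_contra h0
    exact hmin 2 (by omega) (.step c₁ hc₁ h₁ h₁' (.step c₂ hc₂ h₂ h0 (.refl _)))
  · intro u
    -- The pivot creates a nonzero entry at (`r₂`, `c₁`), so `c₁` links `r` directly to `r₂` and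
    -- `r₁` is bypassed.
    refine .step (r' := r₂) c₁ hc₁ ?_ ?_ ?_
    · rwa [pivot_of_col_eq_zero hrr hr2]
    · rw [pivot_off _ _ _ _ hr₂₁ hc, h21, zero_sub, neg_ne_zero]
      exact mul_ne_zero (mul_ne_zero (Units.ne_zero _) h₂') h₁'
    · obtain _ | ⟨c₃, hc₃, h₃, h₃', h⟩ := h
      · exact .refl _
      rename_i n r₃
      -- Rows nonzero at `c₂` are within two links of `r`, too close to lie on the tail of a
      -- shortest chain.
      have far : ∀ m ≤ n, ∀ t, RowChain W A m t s → A t c₂ = 0 := by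
        intro m hm t ht
        by_contra h0
        exact hmin (m + 2) (by omega) (.step c₁ hc₁ h₁ h₁' (.step c₂ hc₂ h₂ h0 ht))
      have h13 : A r₁ c₃ = 0 := by
        by_contra h0
        exact hmin (n + 2) (by omega) (.step c₁ hc₁ h₁ h₁' (.step c₃ hc₃ h0 h₃' h))
      have hc32 : c₃ ≠ c₂ := by rintro rfl; exact h₂ h13
      have hr31 : r₃ ≠ r₁ := by rintro rfl; exact h₃' h13
      refine .step (r' := r₃) c₃ hc₃ ?_ ?_ (h.pivot_of_forall h₂ far)
      · rwa [pivot_of_row_eq_zero hc32 h13]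
      · rwa [pivot_of_row_eq_zero hc32 h13]

theorem RowChain.trans {m n : ℕ} {r s t : X} (h₁ : RowChain W A m r s) (h₂ : RowChain W A n s t) :
    RowChain W A (m + n) r t := by
  induction h₁ with
  | refl r => simpa using h₂
  | step c hc h h' _ ih =>
    rw [Nat.add_right_comm]
    exact .step c hc h h' (ih h₂)

theorem RowChain.symm {n : ℕ} {r s : X} (h : RowChain W A n r s) : RowChain W A n s r := by
  induction h with
  | refl r => exact .refl r
  | step c hc h h' _ ih => exact ih.trans (.step c hc h' h (.refl _))

end Chains

end PartialField

/-! ### Uniqueness of lifts up to scaling -/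

namespace DyadicRing

open PartialField

variable {X Y : Type}

/-- Two `dyadicField`-matrices with the same reduction that agree on the columns in `W` have
proportional entries of column `v` in rows that are linked by the columns in `W`. -/
theorem ratio_eq_of_rowChain {W : Y → Prop} {v : Y} (hv : ¬ W v) (n : ℕ)
    {B C : Matrix X Y DyadicRing} (hB : dyadicField.IsPMatrix B) (hC : dyadicField.IsPMatrix C)
    (hBC : ∀ i j, W j → B i j = C i j) (hφ : B.map toZMod = C.map toZMod) {r s : X}
    (h : RowChain W B n r s) (hr : B r v ≠ 0) (hs : B s v ≠ 0) :
    B r v * C s v = B s v * C r v := by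
  induction n using Nat.strong_induction_on generalizing B C r s with
  | _ n ih =>
  have hφ' : ∀ i j, toZMod (B i j) = toZMod (C i j) := fun i j => congrFun (congrFun hφ i) j
  have hBC0 : ∀ i j, B i j ≠ 0 → C i j ≠ 0 := by
    intro i j h h0
    exact h ((toZMod_eq_zero (hB.apply_mem i j)).1 (by rw [hφ', h0, map_zero]))
  by_cases hmin : ∃ m < n, RowChain W B m r s
  · obtain ⟨m, hm, hm'⟩ := hmin
    exact ih m hm hB hC hBC hφ hm' hr hs
  push Not at hmin
  match n, h with
  | 0, .refl _ => rfl
  | 1, .step c hc h₁ h₂ (.refl _) =>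
    obtain ⟨e, he, h⟩ := exists_fundamental_of_isPMatrix hB h₁ hr h₂ hs
    obtain ⟨f, hf, h'⟩ := exists_fundamental_of_isPMatrix hC (hBC0 _ _ h₁) (hBC0 _ _ hr)
      (hBC0 _ _ h₂) (hBC0 _ _ hs)
    -- Reduction is injective on fundamental elements.
    have hef : e = f := by
      refine he.eq_of_toZMod_eq hf ?_
      have t₁ := congrArg toZMod h
      have t₂ := congrArg toZMod h'
      simp only [map_mul, hφ'] at t₁ t₂
      rw [t₁] at t₂
      refine mul_right_cancel₀ ?_ t₂
      rw [← hφ', ← hφ', ← map_mul, Ne,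
        toZMod_eq_zero ((hB.apply_mem _ _).mul (hB.apply_mem _ _))]
      exact mul_ne_zero hr h₂
    subst hef
    rw [← hBC _ _ hc, ← hBC _ _ hc] at h'
    have he0 : e ≠ 0 := by
      rintro rfl
      rw [zero_mul] at h
      exact mul_ne_zero h₁ hs h
    refine mul_left_cancel₀ (mul_ne_zero (mul_ne_zero he0 h₁) h₂) ?_
    linear_combination (e * B s c * B r v) * h' - (e * B s c * C r v) * h
  | n + 2, h =>
    obtain ⟨r₁, c₁, c₂, hc₁, hc₂, h₁, h₁', h₂, h₀, -, -, hr₁, H⟩ := h.exists_shorten hmin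
    -- If row `r₁` vanishes at `v`, the shortening pivot leaves column `v` unchanged; otherwise the
    -- chain splits at `r₁` into two shorter ones.
    by_cases hr₁v : B r₁ v = 0
    · have hv2 : v ≠ c₂ := by rintro rfl; exact hv hc₂
      obtain ⟨u, hu, huB⟩ := (hB.apply_mem r₁ c₂).exists_unit h₂
      have hC0 : C r₁ v = 0 := by
        rw [← toZMod_eq_zero (hC.apply_mem _ _), ← hφ', hr₁v, map_zero]
      have pB : ∀ i, pivot B r₁ c₂ u i v = B i v := fun i => pivot_of_row_eq_zero hv2 hr₁v
      have pC : ∀ i, pivot C r₁ c₂ u i v = C i v := fun i => pivot_of_row_eq_zero hv2 hC0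
      have := ih (n + 1) (by omega) (hB.pivot hu huB.symm)
        (hC.pivot hu (by rw [← hBC _ _ hc₂, huB])) ?_ ?_ (H u) (by rwa [pB]) (by rwa [pB])
      · simpa only [pB, pC] using this
      · intro i j hj
        simp only [pivot, Matrix.of_apply, hBC _ _ hj, hBC _ _ hc₂]
      · rw [pivot_map, pivot_map, hφ]
    · have e₁ := ih 1 (by omega) hB hC hBC hφ (.step c₁ hc₁ h₁ h₁' (.refl _)) hr hr₁v
      have e₂ := ih (n + 1) (by omega) hB hC hBC hφ hr₁ hr₁v hs
      refine mul_left_cancel₀ (mul_ne_zero hr₁v (hBC0 _ _ hr₁v)) ?_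
      linear_combination (C s v * B r₁ v) * e₁ + (B r₁ v * C r v) * e₂

/-- Units of the dyadic group that are `1` modulo `11`. -/
noncomputable def unitKernel : Subgroup DyadicRingˣ :=
  dyadicField.G ⊓ (Units.map toZMod.toMonoidHom).ker

theorem toZMod_of_mem_unitKernel {u : DyadicRingˣ} (hu : u ∈ unitKernel) :
    toZMod (u : DyadicRing) = 1 :=
  congrArg Units.val (MonoidHom.mem_ker.1 hu.2)

theorem exists_mem_unitKernel {a b : DyadicRing} (ha : dyadicField.Mem a)
    (hb : dyadicField.Mem b) (ha0 : a ≠ 0) (h : toZMod a = toZMod b) :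
    ∃ u ∈ unitKernel, b = u * a := by
  have hb0 : b ≠ 0 := by
    rintro rfl
    rw [map_zero, toZMod_eq_zero ha] at h
    exact ha0 h
  obtain ⟨v, hv, rfl⟩ := ha.exists_unit ha0
  obtain ⟨w, hw, rfl⟩ := hb.exists_unit hb0
  refine ⟨w * v⁻¹, ⟨dyadicField.G.mul_mem hw (dyadicField.G.inv_mem hv), ?_⟩, by simp⟩
  refine MonoidHom.mem_ker.2 ?_
  rw [map_mul, map_inv, mul_inv_eq_one]
  ext
  exact h.symm

/-- Extending a scaling equivalence by one column. -/
theorem exists_scaling_step {W : Y → Prop} {v : Y} (hv : ¬ W v)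
    {B C : Matrix X Y DyadicRing} (hB : dyadicField.IsPMatrix B) (hC : dyadicField.IsPMatrix C)
    (hBC : ∀ i j, W j → B i j = C i j) (hφ : B.map toZMod = C.map toZMod) :
    ∃ (s : X → DyadicRingˣ) (t : Y → DyadicRingˣ), (∀ i, s i ∈ unitKernel) ∧
      (∀ j, t j ∈ unitKernel) ∧ ∀ i j, W j ∨ j = v → C i j = s i * B i j * t j := by
  classical
  have hφ' : ∀ i j, toZMod (B i j) = toZMod (C i j) := fun i j => congrFun (congrFun hφ i) j
  have hq : ∀ i, ∃ u ∈ unitKernel, B i v ≠ 0 → C i v = u * B i v := by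
    intro i
    by_cases h : B i v = 0
    · exact ⟨1, one_mem _, fun h' => absurd h h'⟩
    · obtain ⟨u, hu, h'⟩ := exists_mem_unitKernel (hB.apply_mem i v) (hC.apply_mem i v) h (hφ' i v)
      exact ⟨u, hu, fun _ => h'⟩
  choose q hqk hq using hq
  have hq_eq : ∀ i i' n, RowChain W B n i i' → B i v ≠ 0 → B i' v ≠ 0 → q i = q i' := by
    intro i i' n h h₁ h₂
    have := ratio_eq_of_rowChain hv n hB hC hBC hφ h h₁ h₂
    rw [hq i h₁, hq i' h₂] at this
    ext
    refine mul_left_cancel₀ (mul_ne_zero h₁ h₂) ?_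
    linear_combination -this
  -- `s` is constant on chain components: the common ratio `q` of the rows that meet column `v`, or
  -- 1 if there are none.
  let s : X → DyadicRingˣ := fun i =>
    if h : ∃ i', (∃ n, RowChain W B n i i') ∧ B i' v ≠ 0 then q h.choose else 1
  have hs : ∀ i i' n, RowChain W B n i i' → B i' v ≠ 0 → s i = q i' := by
    intro i i' n h h'
    have hex : ∃ i', (∃ n, RowChain W B n i i') ∧ B i' v ≠ 0 := ⟨i', ⟨n, h⟩, h'⟩
    obtain ⟨⟨m, hm⟩, hm'⟩ := hex.choose_spec
    have : s i = q hex.choose := dif_pos hex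
    rw [this]
    exact hq_eq _ _ _ (hm.symm.trans h) hm' h'
  have hs_eq : ∀ i i' j, W j → B i j ≠ 0 → B i' j ≠ 0 → s i = s i' := by
    intro i i' j hj h h'
    by_cases hex : ∃ k, (∃ n, RowChain W B n i' k) ∧ B k v ≠ 0
    · obtain ⟨k, ⟨n, hn⟩, hk⟩ := hex
      rw [hs i' k n hn hk, hs i k (n + 1) (.step j hj h h' hn) hk]
    · have hex' : ¬ ∃ k, (∃ n, RowChain W B n i k) ∧ B k v ≠ 0 := by
        rintro ⟨k, ⟨n, hn⟩, hk⟩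
        exact hex ⟨k, ⟨n + 1, .step j hj h' h hn⟩, hk⟩
      simp only [s, dif_neg hex, dif_neg hex']
  have hsk : ∀ i, s i ∈ unitKernel := by
    intro i
    by_cases hex : ∃ k, (∃ n, RowChain W B n i k) ∧ B k v ≠ 0
    · simp only [s, dif_pos hex]; exact hqk _
    · simp only [s, dif_neg hex]; exact one_mem _
  -- On a nonzero column of `W`, `t` cancels the common row factor, so the agreement there is kept;
  -- column `v` gets 1.
  let t : Y → DyadicRingˣ := fun j =>
    if h : W j ∧ ∃ i, B i j ≠ 0 then (s h.2.choose)⁻¹ else 1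
  refine ⟨s, t, hsk, ?_, ?_⟩
  · intro j
    by_cases h : W j ∧ ∃ i, B i j ≠ 0
    · simp only [t, dif_pos h]; exact inv_mem (hsk _)
    · simp only [t, dif_neg h]; exact one_mem _
  · rintro i j (hj | rfl)
    · rw [← hBC i j hj]
      by_cases h0 : B i j = 0
      · simp [h0]
      · have h : W j ∧ ∃ i, B i j ≠ 0 := ⟨hj, i, h0⟩
        have ht : t j = (s i)⁻¹ := by
          simp only [t, dif_pos h]
          rw [hs_eq _ i j hj h.2.choose_spec h0]
        rw [ht, mul_right_comm, Units.mul_inv, one_mul]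
    · have ht : t j = 1 := dif_neg fun h => hv h.1
      by_cases h0 : B i j = 0
      · have : C i j = 0 := by
          rw [← toZMod_eq_zero (hC.apply_mem _ _), ← hφ', h0, map_zero]
        simp [h0, this]
      · rw [hs i i 0 (.refl i) h0, ht, hq i h0]; simp

/-- A lift of a matrix over `GF(11)` to the dyadic partial field is unique up to scaling. -/
theorem exists_scaling [Finite Y] {B C : Matrix X Y DyadicRing} (hB : dyadicField.IsPMatrix B)
    (hC : dyadicField.IsPMatrix C) (hφ : B.map toZMod = C.map toZMod) :
    ∃ (s : X → DyadicRingˣ) (t : Y → DyadicRingˣ), (∀ i, s i ∈ unitKernel) ∧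
      (∀ j, t j ∈ unitKernel) ∧ ∀ i j, C i j = s i * B i j * t j := by
  classical
  have := Fintype.ofFinite Y
  suffices H : ∀ T : Finset Y, ∃ (s : X → DyadicRingˣ) (t : Y → DyadicRingˣ),
      (∀ i, s i ∈ unitKernel) ∧ (∀ j, t j ∈ unitKernel) ∧
      ∀ i, ∀ j ∈ T, C i j = s i * B i j * t j by
    obtain ⟨s, t, hs, ht, h⟩ := H Finset.univ
    exact ⟨s, t, hs, ht, fun i j => h i j (Finset.mem_univ j)⟩
  intro T
  induction T using Finset.induction_on with
  | empty => exact ⟨fun _ => 1, fun _ => 1, fun _ => one_mem _, fun _ => one_mem _, by simp⟩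
  | insert v T hv ih =>
    obtain ⟨s, t, hs, ht, h⟩ := ih
    -- `B'` has the same reduction, because the factors are 1 modulo 11, and agrees with `C` on `T`.
    let B' : Matrix X Y DyadicRing := Matrix.of fun i j => (s i : DyadicRing) * B i j * t j
    have hB' : dyadicField.IsPMatrix B' :=
      hB.scale (fun i => (s i : DyadicRing)) (fun j => (t j : DyadicRing))
        (fun i => Mem.of_unit (hs i).1) (fun j => Mem.of_unit (ht j).1)
    have hφ' : B'.map toZMod = C.map toZMod := by
      rw [← hφ]
      ext i j
      simp [B', toZMod_of_mem_unitKernel (hs i), toZMod_of_mem_unitKernel (ht j)]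
    obtain ⟨s', t', hs', ht', h'⟩ := exists_scaling_step (W := (· ∈ T)) hv hB' hC
      (fun i j hj => (h i j hj).symm) hφ'
    refine ⟨fun i => s' i * s i, fun j => t j * t' j, fun i => mul_mem (hs' i) (hs i),
      fun j => mul_mem (ht j) (ht' j), ?_⟩
    intro i j hj
    rw [h' i j ((Finset.mem_insert.1 hj).symm)]
    simp only [B', Matrix.of_apply, Units.val_mul]
    ring

end DyadicRing

/-! ### Recognising a dyadic matrix from two column deletions -/

namespace DyadicRing

open PartialField

variable {X Y : Type}

/-- Deleting column `x` from `A` leaves a `dyadicField`-matrix. -/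
def IsPMatrixOff (x : Y) (A : Matrix X Y DyadicRing) : Prop :=
  dyadicField.IsPMatrix (A.submatrix id (Subtype.val : {j // j ≠ x} → Y))

variable {A : Matrix X Y DyadicRing} {x y : Y}

theorem IsPMatrixOff.det_mem (h : IsPMatrixOff x A) {k : ℕ} (f : Fin k → X) (g : Fin k → Y)
    (hg : ∀ i, g i ≠ x) : dyadicField.Mem (A.submatrix f g).det :=
  IsPMatrix.det_mem h f (fun i => ⟨g i, hg i⟩)

theorem IsPMatrixOff.apply_mem (h : IsPMatrixOff x A) (i : X) {j : Y} (hj : j ≠ x) :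
    dyadicField.Mem (A i j) :=
  IsPMatrix.apply_mem h i (⟨j, hj⟩ : {j // j ≠ x})

theorem IsPMatrixOff.det_two_mem (h : IsPMatrixOff x A) (r s : X) {i j : Y} (hi : i ≠ x)
    (hj : j ≠ x) : dyadicField.Mem (A r i * A s j - A r j * A s i) :=
  IsPMatrix.det_two_mem h r s (⟨i, hi⟩ : {j // j ≠ x}) ⟨j, hj⟩

theorem IsPMatrixOff.pivot (h : IsPMatrixOff x A) {r : X} {c : Y} (hc : c ≠ x) {u : DyadicRingˣ}
    (hu : u ∈ dyadicField.G) (hrc : A r c = u) : IsPMatrixOff x (PartialField.pivot A r c u) := by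
  have := IsPMatrix.pivot (A := A.submatrix id (Subtype.val : {j // j ≠ x} → Y)) h
    (x := r) (y := ⟨c, hc⟩) hu hrc
  rwa [← pivot_submatrix_id Subtype.val_injective] at this

theorem levelRatio_of_det_two (h : IsPMatrixOff x A) {r s : X} {i j : Y} (hi : i ≠ x)
    (hj : j ≠ x) (h₁ : A r i ≠ 0) (h₂ : A s j ≠ 0) (h₃ : A r j ≠ 0) (h₄ : A s i ≠ 0) :
    LevelRatio 1 (A r i * A s j) (A r j * A s i) :=
  levelRatio_one ((h.apply_mem _ hi).mul (h.apply_mem _ hj))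
    ((h.apply_mem _ hj).mul (h.apply_mem _ hi)) (mul_ne_zero h₁ h₂) (mul_ne_zero h₃ h₄)
    (h.det_two_mem r s hi hj)

theorem LevelRatio.mono {m n : ℕ} (h : m ≤ n) {a b : DyadicRing} (hab : LevelRatio m a b) :
    LevelRatio n a b := by
  obtain ⟨e, he, h'⟩ := hab
  exact ⟨e, he.mono h, h'⟩

theorem LevelRatio.neg_right {n : ℕ} {a b : DyadicRing} (hab : LevelRatio n a b) :
    LevelRatio n a (-b) := by
  obtain ⟨e, he, h'⟩ := hab
  exact ⟨-e, he.neg, by rw [h']; ring⟩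

/-- Confinement enters here: it supplies the residue that pins down a ratio known only up to a
bounded exponent. -/
theorem det_two_mem_of_levelRatio (hxy : x ≠ y) (hx : IsPMatrixOff x A) (hy : IsPMatrixOff y A)
    (hA : (ofField (ZMod 11)).IsConfined {2, 6, 10} (A.map toZMod)) {r s : X}
    (h₁ : A r x ≠ 0) (h₂ : A s y ≠ 0) (h₃ : A r y ≠ 0) (h₄ : A s x ≠ 0)
    (h : LevelRatio 3 (A r x * A s y) (A r y * A s x)) :
    dyadicField.Mem (A r x * A s y - A r y * A s x) := by
  have ne : ∀ i, A i x ≠ 0 → (A.map toZMod) i x ≠ 0 := fun i h h0 =>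
    h ((toZMod_eq_zero (hy.apply_mem i hxy)).1 h0)
  have ne' : ∀ i, A i y ≠ 0 → (A.map toZMod) i y ≠ 0 := fun i h h0 =>
    h ((toZMod_eq_zero (hx.apply_mem i hxy.symm)).1 h0)
  obtain ⟨p, hp, hpe⟩ := exists_crossRatio hA (ne r h₁) (ne' r h₃) (ne s h₄) (ne' s h₂)
  refine h.sub_mem ((hx.apply_mem _ hxy.symm).mul (hy.apply_mem _ hxy)) (mul_ne_zero h₃ h₄) hp ?_
  simpa using hpe

/-- Three rows linked by two columns, where the middle row vanishes at exactly one of `x`, `y`. -/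
theorem levelRatio_of_middle_zero (hxy : x ≠ y) (hx : IsPMatrixOff x A) (hy : IsPMatrixOff y A)
    {r r₁ s : X} {c₁ c₂ : Y} (hc₁ : c₁ ≠ x ∧ c₁ ≠ y) (hc₂ : c₂ ≠ x ∧ c₂ ≠ y)
    (a₁ : A r c₁ ≠ 0) (b₁ : A r₁ c₁ ≠ 0) (b₂ : A r₁ c₂ ≠ 0) (a₂ : A r c₂ = 0) (d₂ : A s c₂ ≠ 0)
    (d₁ : A s c₁ = 0) (a₃ : A r x ≠ 0) (a₄ : A r y ≠ 0) (d₃ : A s x ≠ 0) (d₄ : A s y ≠ 0)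
    (b₃ : A r₁ x ≠ 0) (b₄ : A r₁ y = 0) : LevelRatio 3 (A r y * A s x) (A r x * A s y) := by
  have q₁ := levelRatio_of_det_two hy hc₁.2 hxy a₁ b₃ a₃ b₁
  have q₂ := levelRatio_of_det_two hy hc₂.2 hxy b₂ d₃ b₃ d₂
  have m := hx.det_mem ![r, r₁, s] ![c₁, c₂, y] (by
    intro i; fin_cases i <;> simp [hc₁.1, hc₂.1, hxy.symm])
  rw [Matrix.det_fin_three] at m
  -- The zeros leave only two terms of the 3 × 3 determinant, so their ratio is fundamental.
  have m' : dyadicField.Mem (A r y * A r₁ c₁ * A s c₂ - -(A r c₁ * A r₁ c₂ * A s y)) := by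
    convert m using 1
    simp [a₂, d₁, b₄]
    ring
  have M : ∀ i {j}, j ≠ x → dyadicField.Mem (A i j) := fun i j hj => hx.apply_mem i hj
  have q₃ := (levelRatio_one (((M _ hxy.symm).mul (M _ hc₁.1)).mul (M _ hc₂.1))
    (((M _ hc₁.1).mul (M _ hc₂.1)).mul (M _ hxy.symm)).neg
    (mul_ne_zero (mul_ne_zero a₄ b₁) d₂) (neg_ne_zero.2 (mul_ne_zero (mul_ne_zero a₁ b₂) d₄))
    m').neg_right
  -- Three fundamental ratios multiply to the required one, up to a common factor; this case needs
  -- the full exponent bound 3.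
  refine LevelRatio.cancel (c := A r c₁ * A r₁ x * A r₁ c₂ * A r₁ c₁ * A s c₂)
    (mul_ne_zero (mul_ne_zero (mul_ne_zero (mul_ne_zero a₁ b₃) b₂) b₁) d₂) ?_
  convert (q₁.mul q₂).mul q₃ using 1 <;> ring

/-- Three rows linked by two columns, where the middle row vanishes at `x` and `y`. -/
theorem levelRatio_of_middle_zero_zero (hxy : x ≠ y) (hx : IsPMatrixOff x A)
    (hy : IsPMatrixOff y A)
    {r r₁ s : X} {c₁ c₂ : Y} (hc₁ : c₁ ≠ x ∧ c₁ ≠ y) (hc₂ : c₂ ≠ x ∧ c₂ ≠ y)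
    (a₁ : A r c₁ ≠ 0) (b₁ : A r₁ c₁ ≠ 0) (b₂ : A r₁ c₂ ≠ 0) (a₂ : A r c₂ = 0) (d₂ : A s c₂ ≠ 0)
    (d₁ : A s c₁ = 0) (a₃ : A r x ≠ 0) (a₄ : A r y ≠ 0) (d₃ : A s x ≠ 0) (d₄ : A s y ≠ 0)
    (b₃ : A r₁ x = 0) (b₄ : A r₁ y = 0) : LevelRatio 2 (A r x * A s y) (A r y * A s x) := by
  have m := hx.det_mem ![r, r₁, s] ![c₁, c₂, y] (by
    intro i; fin_cases i <;> simp [hc₁.1, hc₂.1, hxy.symm])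
  have n := hy.det_mem ![r, r₁, s] ![c₁, c₂, x] (by
    intro i; fin_cases i <;> simp [hc₁.2, hc₂.2, hxy])
  rw [Matrix.det_fin_three] at m n
  have m' : dyadicField.Mem (A r c₁ * A r₁ c₂ * A s y - -(A r y * A r₁ c₁ * A s c₂)) := by
    convert m using 1
    simp [a₂, d₁, b₄]
  have n' : dyadicField.Mem (A r x * A r₁ c₁ * A s c₂ - -(A r c₁ * A r₁ c₂ * A s x)) := by
    convert n using 1
    simp [a₂, d₁, b₃]
    ring
  have M : ∀ i {j}, j ≠ x → dyadicField.Mem (A i j) := fun i j hj => hx.apply_mem i hj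
  have N : ∀ i {j}, j ≠ y → dyadicField.Mem (A i j) := fun i j hj => hy.apply_mem i hj
  have q₁ := (levelRatio_one (((M _ hc₁.1).mul (M _ hc₂.1)).mul (M _ hxy.symm))
    (((M _ hxy.symm).mul (M _ hc₁.1)).mul (M _ hc₂.1)).neg
    (mul_ne_zero (mul_ne_zero a₁ b₂) d₄) (neg_ne_zero.2 (mul_ne_zero (mul_ne_zero a₄ b₁) d₂))
    m')
  have q₂ := (levelRatio_one (((N _ hxy).mul (N _ hc₁.2)).mul (N _ hc₂.2))
    (((N _ hc₁.2).mul (N _ hc₂.2)).mul (N _ hxy)).neg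
    (mul_ne_zero (mul_ne_zero a₃ b₁) d₂) (neg_ne_zero.2 (mul_ne_zero (mul_ne_zero a₁ b₂) d₃))
    n')
  -- Each 3 × 3 determinant contributes one fundamental ratio, hence exponent at most 2.
  refine LevelRatio.cancel (c := A r c₁ * A r₁ c₂ * A r₁ c₁ * A s c₂)
    (mul_ne_zero (mul_ne_zero (mul_ne_zero a₁ b₂) b₁) d₂) ?_
  convert q₁.mul q₂ using 1 <;> ring

theorem isConfined_map_pivot (hA : (ofField (ZMod 11)).IsConfined {2, 6, 10} (A.map toZMod))
    {r : X} {c : Y} {u : DyadicRingˣ} (hu : A r c = u) :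
    (ofField (ZMod 11)).IsConfined {2, 6, 10} ((pivot A r c u).map toZMod) := by
  refine (crossRatios_subset_of_minorOf ?_).trans hA
  rw [pivot_map]
  refine MinorOf.refl.pivot r c _ (Subgroup.mem_top _) ?_
  simp [hu]

/-- Pivots outside `x` and `y` shorten the chain to at most two links. The ratio of the two terms is
then a product of at most three fundamental ratios, and confinement does the rest. -/
theorem det_two_mem_of_rowChain (hxy : x ≠ y) (n : ℕ) {A : Matrix X Y DyadicRing}
    (hx : IsPMatrixOff x A) (hy : IsPMatrixOff y A)
    (hA : (ofField (ZMod 11)).IsConfined {2, 6, 10} (A.map toZMod)) {r s : X}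
    (h : RowChain (fun j => j ≠ x ∧ j ≠ y) A n r s) :
    dyadicField.Mem (A r x * A s y - A r y * A s x) := by
  induction n using Nat.strong_induction_on generalizing A r s with
  | _ n ih =>
  have Mx : ∀ i, dyadicField.Mem (A i x) := fun i => hy.apply_mem i hxy
  have My : ∀ i, dyadicField.Mem (A i y) := fun i => hx.apply_mem i hxy.symm
  by_cases a₃ : A r x = 0
  · rw [a₃, zero_mul, zero_sub]; exact ((My _).mul (Mx _)).neg
  by_cases a₄ : A r y = 0
  · rw [a₄, zero_mul, sub_zero]; exact (Mx _).mul (My _)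
  by_cases d₃ : A s x = 0
  · rw [d₃, mul_zero, sub_zero]; exact (Mx _).mul (My _)
  by_cases d₄ : A s y = 0
  · rw [d₄, mul_zero, zero_sub]; exact ((My _).mul (Mx _)).neg
  by_cases hmin : ∃ m < n, RowChain (fun j => j ≠ x ∧ j ≠ y) A m r s
  · obtain ⟨m, hm, hm'⟩ := hmin
    exact ih m hm hx hy hA hm'
  push Not at hmin
  match n, h with
  | 0, .refl _ =>
    rw [mul_comm, sub_self]; exact Mem.zero
  | 1, .step c hc h₁ h₂ (.refl _) =>
    have q₁ := levelRatio_of_det_two hy hxy hc.2 a₃ h₂ h₁ d₃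
    have q₂ := levelRatio_of_det_two hx hc.1 hxy.symm h₁ d₄ a₄ h₂
    refine det_two_mem_of_levelRatio hxy hx hy hA a₃ d₄ a₄ d₃ (LevelRatio.mono (m := 2) (by omega)
      (LevelRatio.cancel (c := A s c * A r c) (mul_ne_zero h₂ h₁) ?_))
    convert q₁.mul q₂ using 1 <;> ring
  | n + 2, h =>
    obtain ⟨r₁, c₁, c₂, hc₁, hc₂, a₁, b₁, b₂, a₂, hn, hn', hr₁, H⟩ := h.exists_shorten hmin
    by_cases hn0 : n = 0
    · obtain ⟨d₂, d₁⟩ := hn hn0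
      subst hn0
      by_cases b₃ : A r₁ x = 0 <;> by_cases b₄ : A r₁ y = 0
      · exact det_two_mem_of_levelRatio hxy hx hy hA a₃ d₄ a₄ d₃
          ((levelRatio_of_middle_zero_zero hxy hx hy hc₁ hc₂ a₁ b₁ b₂ a₂ d₂ d₁ a₃ a₄ d₃ d₄ b₃
            b₄).mono (by omega))
      · exact det_two_mem_of_levelRatio hxy hx hy hA a₃ d₄ a₄ d₃
          (levelRatio_of_middle_zero hxy.symm hy hx hc₁.symm hc₂.symm a₁ b₁ b₂ a₂ d₂ d₁ a₄ a₃ d₄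
            d₃ b₄ b₃)
      -- The bound is available for the inverse ratio, so the determinant is taken with its columns
      -- exchanged.
      · rw [← neg_sub]
        exact (det_two_mem_of_levelRatio hxy.symm hy hx hA a₄ d₃ a₃ d₄
          (levelRatio_of_middle_zero hxy hx hy hc₁ hc₂ a₁ b₁ b₂ a₂ d₂ d₁ a₃ a₄ d₃ d₄ b₃ b₄)).neg
      · have m₁ := ih 1 (by omega) hx hy hA (.step c₁ hc₁ a₁ b₁ (.refl r₁))
        have m₂ := ih 1 (by omega) hx hy hA hr₁
        have q₁ := levelRatio_one ((Mx _).mul (My _)) ((My _).mul (Mx _)) (mul_ne_zero a₃ b₄)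
          (mul_ne_zero a₄ b₃) m₁
        have q₂ := levelRatio_one ((Mx _).mul (My _)) ((My _).mul (Mx _)) (mul_ne_zero b₃ d₄)
          (mul_ne_zero b₄ d₃) m₂
        refine det_two_mem_of_levelRatio hxy hx hy hA a₃ d₄ a₄ d₃
          (LevelRatio.mono (m := 2) (by omega)
            (LevelRatio.cancel (c := A r₁ x * A r₁ y) (mul_ne_zero b₃ b₄) ?_))
        convert q₁.mul q₂ using 1 <;> ring
    · have d₂ := hn' hn0
      obtain ⟨u, hu, huA⟩ := (hx.apply_mem r₁ hc₂.1).exists_unit b₂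
      have hr : r ≠ r₁ := by rintro rfl; exact b₂ a₂
      have hs : s ≠ r₁ := by rintro rfl; exact b₂ d₂
      -- Rows `r` and `s` vanish at `c₂`, so this pivot shortens the chain without changing the
      -- determinant.
      have := ih (n + 1) (by omega) (hx.pivot hc₂.1 hu huA.symm) (hy.pivot hc₂.2 hu huA.symm)
        (isConfined_map_pivot hA huA.symm) (H u)
      simpa only [pivot_of_col_eq_zero hr a₂, pivot_of_col_eq_zero hs d₂] using this

/-- The support of `A` in the columns in `W` has no separation that splits the rows. -/
def RowConnected {R : Type*} [Zero R] (W : Y → Prop) (A : Matrix X Y R) : Prop :=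
  ∀ (c : X → Prop) (d : Y → Prop), (∀ i j, W j → A i j ≠ 0 → (c i ↔ d j)) → ∀ i i', c i → c i'

/-- A separation of the support of `A` is a separation of the support of any pivot of `A`. -/
theorem separation_pivot {R : Type*} [CommRing R] {W : Y → Prop} {A : Matrix X Y R} {c : X → Prop}
    {d : Y → Prop} (h : ∀ i j, W j → A i j ≠ 0 → (c i ↔ d j)) {x : X} {y : Y} {u : Rˣ} (hy : W y)
    (hcd : c x ↔ d y) : ∀ i j, W j → pivot A x y u i j ≠ 0 → (c i ↔ d j) := by
  intro i j hj h0
  by_cases hi : i = x <;> by_cases hj' : j = y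
  · rw [hi, hj', hcd]
  · rw [hi] at h0 ⊢
    rw [pivot_row _ _ _ _ hj'] at h0
    exact h _ _ hj (right_ne_zero_of_mul h0)
  · rw [hj'] at h0 ⊢
    rw [pivot_col _ _ _ _ hi, neg_ne_zero] at h0
    exact h _ _ hy (right_ne_zero_of_mul h0)
  · rw [pivot_off _ _ _ _ hi hj'] at h0
    by_cases h1 : A i j = 0
    · rw [h1, zero_sub, neg_ne_zero] at h0
      have h2 := right_ne_zero_of_mul h0
      have h3 := right_ne_zero_of_mul (left_ne_zero_of_mul h0)
      rw [h i y hy h3, ← hcd, h x j hj h2]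
    · exact h _ _ hj h1

theorem RowConnected.pivot {R : Type*} [CommRing R] [Nontrivial R] {W : Y → Prop}
    {A : Matrix X Y R} (hA : RowConnected W A) {x : X} {y : Y} {u : Rˣ} (hy : W y)
    (h : A x y = u) : RowConnected W (PartialField.pivot A x y u) := by
  intro c d hcd
  refine hA c d ?_
  have hxy : c x ↔ d y := hcd x y hy (by rw [pivot_self]; exact Units.ne_zero _)
  -- Pivoting back carries a separation of the pivot to one of `A`.
  have := separation_pivot (u := u⁻¹) hcd hy hxy
  rwa [pivot_pivot h] at this

/-- The rows reachable from `r`, with the columns they meet, form one side of a separation. -/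
theorem RowConnected.exists_rowChain {R : Type*} [CommRing R] {W : Y → Prop} {A : Matrix X Y R}
    (hA : RowConnected W A) (r s : X) : ∃ n, RowChain W A n r s := by
  refine hA (fun i => ∃ n, RowChain W A n r i)
    (fun j => ∃ i, (∃ n, RowChain W A n r i) ∧ A i j ≠ 0) ?_ r s ⟨0, .refl r⟩
  intro i j hj h0
  constructor
  · exact fun h => ⟨i, h, h0⟩
  · rintro ⟨i', ⟨n, hn⟩, h'⟩
    exact ⟨n + 1, hn.trans (.step j hj h' h0 (.refl i))⟩

/-- If two columns can each be deleted to obtain a matrix over the dyadic partial field, then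
the matrix itself is one, provided that the rest is connected and the reduction is confined. -/
theorem isPMatrix_of_isPMatrixOff (hxy : x ≠ y) {A : Matrix X Y DyadicRing}
    (hx : IsPMatrixOff x A) (hy : IsPMatrixOff y A)
    (hA : (ofField (ZMod 11)).IsConfined {2, 6, 10} (A.map toZMod))
    (hc : RowConnected (fun j => j ≠ x ∧ j ≠ y) A) : dyadicField.IsPMatrix A := by
  intro k
  induction k generalizing A with
  | zero => intro f g; simpa using Mem.one
  | succ k ih =>
    intro f g
    by_cases hgx : ∃ a, g a = x
    swap
    · push Not at hgx
      exact hx.det_mem f g hgx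
    by_cases hgy : ∃ b, g b = y
    swap
    · push Not at hgy
      exact hy.det_mem f g hgy
    -- A selected column other than `x` and `y` can be pivoted away, since all hypotheses survive
    -- the pivot; with none left the determinant is 2 × 2.
    by_cases hp : ∃ p, g p ≠ x ∧ g p ≠ y
    · obtain ⟨p, hpx, hpy⟩ := hp
      by_cases h0 : ∀ i, A (f i) (g p) = 0
      · rw [Matrix.det_eq_zero_of_column_eq_zero p (by simpa using h0)]
        exact Mem.zero
      · push Not at h0
        obtain ⟨q, hq⟩ := h0
        obtain ⟨u, hu, huA⟩ := (hx.apply_mem (f q) hpx).exists_unit hq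
        rw [det_submatrix_eq_pivot f.injective g.injective q p huA.symm, mul_assoc]
        exact Mem.neg_one_pow_mul _ ((Mem.of_unit hu).mul
          (ih (hx.pivot hpx hu huA.symm) (hy.pivot hpy hu huA.symm)
            (isConfined_map_pivot hA huA.symm) (hc.pivot ⟨hpx, hpy⟩ huA.symm)
            (q.succAboveEmb.trans f) (p.succAboveEmb.trans g)))
    · push Not at hp
      obtain ⟨a, ha⟩ := hgx
      obtain ⟨b, hb⟩ := hgy
      have hab : a ≠ b := by rintro rfl; exact hxy (ha.symm.trans hb)
      have huniv : ∀ p, p = a ∨ p = b := by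
        intro p
        by_cases hpx : g p = x
        · left; exact g.injective (hpx.trans ha.symm)
        · right; exact g.injective ((hp p hpx).trans hb.symm)
      have hk : k + 1 = 2 := by
        have h1 : (Finset.univ : Finset (Fin (k + 1))) = {a, b} := by
          ext p; simpa using huniv p
        have h2 := congrArg Finset.card h1
        rwa [Finset.card_pair hab, Finset.card_univ, Fintype.card_fin] at h2
      obtain rfl : k = 1 := by omega
      have key : ∀ r s, dyadicField.Mem (A r x * A s y - A r y * A s x) := by
        intro r s
        obtain ⟨n, hn⟩ := hc.exists_rowChain r s
        exact det_two_mem_of_rowChain hxy n hx hy hA hn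
      rw [Matrix.det_fin_two]
      simp only [Matrix.submatrix_apply]
      have h01 : (g 0 = x ∧ g 1 = y) ∨ (g 0 = y ∧ g 1 = x) := by
        fin_cases a <;> fin_cases b <;> simp_all
      rcases h01 with ⟨h0, h1⟩ | ⟨h0, h1⟩ <;> rw [h0, h1]
      · exact key _ _
      · rw [← neg_sub]; exact (key _ _).neg

end DyadicRing

/-! ### Spanning trees with three leaves -/

namespace SimpleGraph

variable {V : Type*}

theorem Connected.exists_adj_dist_lt {G : SimpleGraph V} (hG : G.Connected) {w v : V}
    (h : v ≠ w) : ∃ p, G.Adj v p ∧ G.dist w p < G.dist w v := by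
  obtain ⟨q, hq⟩ := hG.exists_walk_length_eq_dist v w
  cases q with
  | nil => exact absurd rfl h
  | @cons _ p _ hadj q =>
    refine ⟨p, hadj, ?_⟩
    rw [Walk.length_cons] at hq
    rw [dist_comm, dist_comm (u := w), ← hq]
    exact Nat.lt_succ_of_le (dist_le q)

/-- A connected graph with a vertex `w` of degree at least three has a spanning tree, rooted
at `w` and given by its parent function, with three leaves. -/
theorem Connected.exists_three_leaves [Finite V] {G : SimpleGraph V} (hG : G.Connected) {w : V}
    {nb : Fin 3 → V} (hnb : Function.Injective nb) (hadj : ∀ a, G.Adj w (nb a)) :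
    ∃ (u : Fin 3 → V) (par : V → V), Function.Injective u ∧ (∀ a, u a ≠ w) ∧
      (∀ v, v ≠ w → G.Adj v (par v) ∧ G.dist w (par v) < G.dist w v) ∧
      ∀ v a, v ≠ w → par v ≠ u a := by
  classical
  choose! par hpar using fun v => hG.exists_adj_dist_lt (w := w) (v := v)
  -- Parents are strictly closer to `w`; fixing `w` makes `p` a total map whose iterates describe
  -- ancestry.
  let p : V → V := fun v => if v = w then w else par v
  have hpw : p w = w := if_pos rfl
  have hp : ∀ v, v ≠ w → p v = par v := fun v hv => if_neg hv
  have hne : ∀ a, nb a ≠ w := fun a => (hadj a).ne'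
  have hpn : ∀ a, p (nb a) = w := by
    intro a
    rw [hp _ (hne a)]
    have h1 := (hpar _ (hne a)).2
    rw [dist_eq_one_iff_adj.2 (hadj a), Nat.lt_one_iff, hG.dist_eq_zero_iff] at h1
    exact h1.symm
  have hiter : ∀ m, p^[m] w = w := fun m => Function.iterate_fixed hpw m
  -- The branches through distinct neighbours of `w` are disjoint.
  have hsep : ∀ a b k, p^[k] (nb a) = nb b → a = b := by
    intro a b k hk
    cases k with
    | zero => exact hnb hk
    | succ k =>
      rw [Function.iterate_succ_apply, hpn, hiter] at hk
      exact absurd hk.symm (hne b)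
  -- A vertex of the branch farthest from `w` is a leaf, since a child would be in the same branch
  -- and farther away.
  have hmax : ∀ a, ∃ u, (∃ m, p^[m] u = nb a) ∧
      ∀ v, (∃ m, p^[m] v = nb a) → G.dist w v ≤ G.dist w u := by
    intro a
    obtain ⟨u, hu, hu'⟩ := Set.exists_max_image {v | ∃ m, p^[m] v = nb a} (G.dist w)
      (Set.toFinite _) ⟨nb a, 0, rfl⟩
    exact ⟨u, hu, hu'⟩
  choose u hu hu' using hmax
  refine ⟨u, par, ?_, ?_, hpar, ?_⟩
  · intro a b hab
    obtain ⟨m, hm⟩ := hu a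
    obtain ⟨m', hm'⟩ := hu b
    rw [← hab] at hm'
    rcases le_total m m' with h | h
    · obtain ⟨k, rfl⟩ := Nat.exists_eq_add_of_le' h
      rw [Function.iterate_add_apply, hm] at hm'
      exact hsep _ _ _ hm'
    · obtain ⟨k, rfl⟩ := Nat.exists_eq_add_of_le' h
      rw [Function.iterate_add_apply, hm'] at hm
      exact (hsep _ _ _ hm).symm
  · intro a ha
    obtain ⟨m, hm⟩ := hu a
    rw [ha, hiter] at hm
    exact hne a hm.symm
  · intro v a hv hva
    obtain ⟨m, hm⟩ := hu a
    have := hu' a v ⟨m + 1, by rw [Function.iterate_succ_apply, hp v hv, hva, hm]⟩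
    have := (hpar v hv).2
    rw [hva] at this
    omega

end SimpleGraph

/-! ### Connectivity of the support graph -/

namespace DyadicRing

open PartialField

section Connectivity

variable {X Y : Type} {R : Type*} [CommRing R]

/-- The support of `A` has no proper separation. -/
def IsConnected (A : Matrix X Y R) : Prop :=
  ∀ (c : X → Prop) (d : Y → Prop), (∀ i j, A i j ≠ 0 → (c i ↔ d j)) →
    ∀ a b, Sum.elim c d a → Sum.elim c d b

/-- The bipartite graph of the support of `A`. -/
def supportGraph (A : Matrix X Y R) : SimpleGraph (X ⊕ Y) :=
  SimpleGraph.fromRel fun a b => ∃ i j, a = Sum.inl i ∧ b = Sum.inr j ∧ A i j ≠ 0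

variable {A : Matrix X Y R}

@[simp] theorem supportGraph_adj_inl_inr {i : X} {j : Y} :
    (supportGraph A).Adj (Sum.inl i) (Sum.inr j) ↔ A i j ≠ 0 := by
  simp [supportGraph]

@[simp] theorem supportGraph_adj_inr_inl {i : X} {j : Y} :
    (supportGraph A).Adj (Sum.inr j) (Sum.inl i) ↔ A i j ≠ 0 := by
  simp [supportGraph]

@[simp] theorem not_supportGraph_adj_inl_inl {i i' : X} :
    ¬ (supportGraph A).Adj (Sum.inl i) (Sum.inl i') := by
  simp [supportGraph]

@[simp] theorem not_supportGraph_adj_inr_inr {j j' : Y} :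
    ¬ (supportGraph A).Adj (Sum.inr j) (Sum.inr j') := by
  simp [supportGraph]

theorem IsConnected.supportGraph_connected (hA : IsConnected A) (a₀ : X ⊕ Y) :
    (supportGraph A).Connected := by
  have key : ∀ b, (supportGraph A).Reachable a₀ b := by
    intro b
    have := hA (fun i => (supportGraph A).Reachable a₀ (Sum.inl i))
      (fun j => (supportGraph A).Reachable a₀ (Sum.inr j)) (by
        intro i j h
        have hadj : (supportGraph A).Adj (Sum.inl i) (Sum.inr j) := by simpa using h
        exact ⟨fun h => h.trans hadj.reachable, fun h => h.trans hadj.symm.reachable⟩) a₀ b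
      (by cases a₀ <;> simp)
    cases b <;> simpa using this
  have : Nonempty (X ⊕ Y) := ⟨a₀⟩
  exact ⟨fun a b => (key a).symm.trans (key b)⟩

theorem IsConnected.transpose (hA : IsConnected A) : IsConnected A.transpose := by
  intro c d h a b hab
  have := hA d c (fun i j h0 => (h j i h0).symm) a.swap b.swap
  cases a <;> cases b <;> exact this hab

theorem IsConnected.pivot [Nontrivial R] (hA : IsConnected A) {x : X} {y : Y} {u : Rˣ}
    (h : A x y = u) : IsConnected (PartialField.pivot A x y u) := by
  intro c d hcd
  refine hA c d ?_
  have hxy : c x ↔ d y := hcd x y (by rw [pivot_self]; exact Units.ne_zero _)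
  have := separation_pivot (W := fun _ => True) (u := u⁻¹) (fun i j _ => hcd i j) trivial hxy
  rw [pivot_pivot h] at this
  exact fun i j => this i j trivial

/-- If the support of `A` is connected and some row or column has at least three nonzero
entries, then two columns, or two rows, can be deleted without disconnecting the rest. -/
theorem IsConnected.exists_pair [Finite X] [Finite Y] (hA : IsConnected A) {w : X ⊕ Y}
    {nb : Fin 3 → X ⊕ Y} (hnb : Function.Injective nb)
    (hadj : ∀ a, (supportGraph A).Adj w (nb a)) :
    (∃ x y : Y, x ≠ y ∧ RowConnected (fun j => j ≠ x ∧ j ≠ y) A) ∨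
      ∃ x y : X, x ≠ y ∧ RowConnected (fun j => j ≠ x ∧ j ≠ y) A.transpose := by
  have hG := hA.supportGraph_connected w
  obtain ⟨u, par, hu, huw, hpar, hleaf⟩ := hG.exists_three_leaves hnb hadj
  -- Following parents to `w` never meets a deleted leaf, so the tree still connects all remaining
  -- vertices.
  have key : ∀ (a b : Fin 3) (E : X ⊕ Y → Prop),
      (∀ v v', v ≠ u a → v ≠ u b → v' ≠ u a → v' ≠ u b → (supportGraph A).Adj v v' →
        (E v ↔ E v')) → ∀ v, v ≠ u a → v ≠ u b → (E v ↔ E w) := by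
    intro a b E hE v
    induction hn : (supportGraph A).dist w v using Nat.strong_induction_on generalizing v with
    | _ n ih =>
    intro hva hvb
    by_cases hvw : v = w
    · rw [hvw]
    · obtain ⟨h1, h2⟩ := hpar v hvw
      have ha := hleaf v a hvw
      have hb := hleaf v b hvw
      rw [hE v (par v) hva hvb ha hb h1]
      exact ih _ (hn ▸ h2) (par v) rfl ha hb
  -- Of three leaves, two are on the same side of the bipartition.
  obtain ⟨a, b, hab, hlr⟩ := Fintype.exists_ne_map_eq_of_card_lt (fun a => (u a).isLeft)
    (by simp)
  have hne := hu.ne hab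
  rcases hx : u a with x | x <;> rcases hy : u b with y | y <;>
    simp only [hx, hy, Sum.isLeft_inl, Sum.isLeft_inr, reduceCtorEq] at hlr
  · right
    refine ⟨x, y, fun h => hne (by rw [hx, hy, h]), ?_⟩
    intro c d hcd
    have := key a b (Sum.elim d c) (by
      rw [hx, hy]
      rintro (i | j) (i' | j') h1 h2 h3 h4 h
      · simp at h
      · exact (hcd j' i ⟨by simpa using h1, by simpa using h2⟩ (by simpa using h)).symm
      · exact hcd j i' ⟨by simpa using h3, by simpa using h4⟩ (by simpa using h)
      · simp at h)
    rw [hx, hy] at this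
    intro j j' hj
    have h1 := this (Sum.inr j) (by simp) (by simp)
    have h2 := this (Sum.inr j') (by simp) (by simp)
    exact h2.2 (h1.1 hj)
  · left
    refine ⟨x, y, fun h => hne (by rw [hx, hy, h]), ?_⟩
    intro c d hcd
    have := key a b (Sum.elim c d) (by
      rw [hx, hy]
      rintro (i | j) (i' | j') h1 h2 h3 h4 h
      · simp at h
      · exact hcd i j' ⟨by simpa using h3, by simpa using h4⟩ (by simpa using h)
      · exact (hcd i' j ⟨by simpa using h1, by simpa using h2⟩ (by simpa using h)).symm
      · simp at h)
    rw [hx, hy] at this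
    intro i i' hi
    have h1 := this (Sum.inl i) (by simp) (by simp)
    have h2 := this (Sum.inl i') (by simp) (by simp)
    exact h2.2 (h1.1 hi)

end Connectivity

end DyadicRing

/-! ### Constructions of lifts -/

namespace DyadicRing

open PartialField

variable {X Y : Type}

/-- `A` is the reduction of a matrix over the dyadic partial field. -/
def Liftable (A : Matrix X Y (ZMod 11)) : Prop :=
  ∃ B : Matrix X Y DyadicRing, dyadicField.IsPMatrix B ∧ B.map toZMod = A

/-- All cross ratios of `A` are reductions of dyadic fundamental elements. -/
abbrev Confined (A : Matrix X Y (ZMod 11)) : Prop :=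
  (ofField (ZMod 11)).IsConfined {2, 6, 10} A

theorem Confined.of_minorOf {X' Y' : Type} {A : Matrix X Y (ZMod 11)} {B : Matrix X' Y' (ZMod 11)}
    (hA : Confined A) (h : (ofField (ZMod 11)).MinorOf A B) : Confined B :=
  (crossRatios_subset_of_minorOf h).trans hA

theorem Confined.submatrix {X' Y' : Type} {A : Matrix X Y (ZMod 11)} (hA : Confined A)
    (f : X' ↪ X) (g : Y' ↪ Y) : Confined (A.submatrix f g) :=
  hA.of_minorOf (MinorOf.refl.submatrix f g)

theorem Confined.transpose {A : Matrix X Y (ZMod 11)} (hA : Confined A) : Confined A.transpose :=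
  (crossRatios_transpose_subset A).trans hA

theorem Confined.pivot {A : Matrix X Y (ZMod 11)} (hA : Confined A) {x : X} {y : Y}
    {u : (ZMod 11)ˣ} (h : A x y = u) : Confined (PartialField.pivot A x y u) :=
  hA.of_minorOf (MinorOf.refl.pivot x y u (Subgroup.mem_top _) h)

theorem Liftable.transpose {A : Matrix X Y (ZMod 11)} (h : Liftable A) : Liftable A.transpose := by
  obtain ⟨B, hB, rfl⟩ := h
  exact ⟨B.transpose, hB.transpose, rfl⟩

theorem liftable_of_pivot {A : Matrix X Y (ZMod 11)} {x : X} {y : Y} {u : (ZMod 11)ˣ}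
    (h : A x y = u) (hp : Liftable (pivot A x y u)) : Liftable A := by
  obtain ⟨B, hB, hBA⟩ := hp
  have hxy : toZMod (B x y) = ((u⁻¹ : (ZMod 11)ˣ) : ZMod 11) := by
    have := congrFun (congrFun hBA x) y
    rwa [pivot_self] at this
  have h0 : B x y ≠ 0 := by
    intro h0
    rw [h0, map_zero] at hxy
    exact Units.ne_zero _ hxy.symm
  obtain ⟨v, hv, hvB⟩ := (hB.apply_mem x y).exists_unit h0
  refine ⟨pivot B x y v, hB.pivot hv hvB.symm, ?_⟩
  have hu : Units.map toZMod.toMonoidHom v = u⁻¹ := by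
    ext
    rw [← hxy, ← hvB]
    rfl
  rw [pivot_map, hBA, hu, pivot_pivot h]

theorem liftable_of_isEmpty [IsEmpty X] (A : Matrix X Y (ZMod 11)) : Liftable A := by
  refine ⟨0, ?_, Subsingleton.elim _ _⟩
  intro k f g
  cases k with
  | zero => simpa using Mem.one
  | succ k => exact isEmptyElim (f 0)

/-- Expansion along row `i` has at most one nonzero term, so any dyadic lift of that row will do. -/
theorem liftable_of_row {A : Matrix X Y (ZMod 11)} (i : X)
    (hi : ∀ j j', A i j ≠ 0 → A i j' ≠ 0 → j = j')
    (h : Liftable (A.submatrix (Subtype.val : {i' // i' ≠ i} → X) id)) : Liftable A := by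
  classical
  obtain ⟨B, hB, hBA⟩ := h
  choose σ hσ hσA using fun j => exists_mem_toZMod_eq (A i j)
  have hσ0 : ∀ j, σ j ≠ 0 → A i j ≠ 0 := by
    intro j hj h0
    exact hj ((toZMod_eq_zero (hσ j)).1 ((hσA j).trans h0))
  let C : Matrix X Y DyadicRing := Matrix.of fun i' j => if h : i' = i then σ j else B ⟨i', h⟩ j
  have hCi : ∀ j, C i j = σ j := fun j => dif_pos rfl
  have hoff : ∀ {k : ℕ} (f : Fin k → X) (g : Fin k → Y), (∀ a, f a ≠ i) →
      dyadicField.Mem (C.submatrix f g).det := by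
    intro k f g hf
    have : C.submatrix f g = B.submatrix (fun a => ⟨f a, hf a⟩) g := by
      ext a b
      simp [C, hf a]
    rw [this]
    exact hB.det_mem _ _
  refine ⟨C, ?_, ?_⟩
  · intro k f g
    by_cases hf : ∃ q, f q = i
    · obtain ⟨q, hq⟩ := hf
      cases k with
      | zero => exact q.elim0
      | succ k =>
        by_cases h0 : ∀ b, C i (g b) = 0
        · rw [Matrix.det_eq_zero_of_row_eq_zero q (by intro b; simpa [hq] using h0 b)]
          exact Mem.zero
        · push Not at h0
          obtain ⟨p, hp⟩ := h0
          rw [Matrix.det_succ_row _ q, Finset.sum_eq_single p]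
          · rw [mul_assoc, Matrix.submatrix_submatrix]
            refine Mem.neg_one_pow_mul _ (Mem.mul ?_ (hoff _ _ ?_))
            · rw [Matrix.submatrix_apply, hq, hCi]
              exact hσ _
            · intro a ha
              exact Fin.succAbove_ne q a (f.injective (ha.trans hq.symm))
          · intro b _ hb
            have : C i (g b) = 0 := by
              by_contra hne
              rw [hCi] at hp hne
              exact hb (g.injective (hi _ _ (hσ0 _ hne) (hσ0 _ hp)))
            simp [hq, this]
          · simp
    · push Not at hf
      exact hoff f g hf
  · ext i' j
    by_cases h : i' = i
    · subst h; simp [hCi, hσA]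
    · have := congrFun (congrFun hBA ⟨i', h⟩) j
      simpa [C, h] using this

/-- The block of `B` on the rows in `c` and the columns in `d`. -/
abbrev block {R : Type*} (c : X → Prop) (d : Y → Prop) (B : Matrix X Y R) :
    Matrix {i // c i} {j // d j} R :=
  B.submatrix Subtype.val Subtype.val

theorem block_pivot {R : Type*} [CommRing R] {c : X → Prop} {d : Y → Prop} {B : Matrix X Y R}
    {x : X} {y : Y} {u : Rˣ} (hx : c x) (hy : d y) :
    block c d (pivot B x y u) = pivot (block c d B) ⟨x, hx⟩ ⟨y, hy⟩ u :=
  pivot_submatrix Subtype.val_injective Subtype.val_injective (⟨x, hx⟩ : {i // c i}) ⟨y, hy⟩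

theorem block_pivot_of_not {R : Type*} [CommRing R] {c : X → Prop} {d : Y → Prop}
    {B : Matrix X Y R} (hB : ∀ i j, B i j ≠ 0 → (c i ↔ d j)) {x : X} {y : Y} {u : Rˣ}
    (hx : ¬ c x) (hy : ¬ d y) : block c d (pivot B x y u) = block c d B := by
  ext ⟨i, hi⟩ ⟨j, hj⟩
  have : B i y = 0 := by
    by_contra h
    exact hy ((hB i y h).1 hi)
  exact pivot_of_col_eq_zero (fun h => hx (h ▸ hi)) this

/-- Block-diagonal matrices with dyadic blocks are closed under pivoting: a pivot acts within one
block and fixes the other. This replaces a computation of their subdeterminants. -/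
theorem liftable_of_separation {A : Matrix X Y (ZMod 11)} {c : X → Prop} {d : Y → Prop}
    (hcd : ∀ i j, A i j ≠ 0 → (c i ↔ d j)) (h₁ : Liftable (block c d A))
    (h₂ : Liftable (block (fun i => ¬ c i) (fun j => ¬ d j) A)) : Liftable A := by
  classical
  obtain ⟨B₁, hB₁, hBA₁⟩ := h₁
  obtain ⟨B₂, hB₂, hBA₂⟩ := h₂
  let C : Matrix X Y DyadicRing := Matrix.of fun i j =>
    if hi : c i then if hj : d j then B₁ ⟨i, hi⟩ ⟨j, hj⟩ else 0
    else if hj : d j then 0 else B₂ ⟨i, hi⟩ ⟨j, hj⟩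
  let P : Matrix X Y DyadicRing → Prop := fun B => (∀ i j, B i j ≠ 0 → (c i ↔ d j)) ∧
    dyadicField.IsPMatrix (block c d B) ∧
    dyadicField.IsPMatrix (block (fun i => ¬ c i) (fun j => ¬ d j) B)
  have hCP : P C := by
    refine ⟨?_, ?_, ?_⟩
    · intro i j h
      by_cases hi : c i <;> by_cases hj : d j <;> simp_all [C]
    · convert hB₁ using 1
      ext ⟨i, hi⟩ ⟨j, hj⟩
      simp [C, hi, hj]
    · convert hB₂ using 1
      ext ⟨i, hi⟩ ⟨j, hj⟩
      simp [C, hi, hj]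
  refine ⟨C, isPMatrix_of_pivot_closed P ?_ ?_ hCP, ?_⟩
  · rintro B ⟨hB, hb₁, hb₂⟩ i j
    by_cases h0 : B i j = 0
    · rw [h0]; exact Mem.zero
    · by_cases hi : c i
      · exact hb₁.apply_mem ⟨i, hi⟩ ⟨j, (hB i j h0).1 hi⟩
      · exact hb₂.apply_mem ⟨i, hi⟩ ⟨j, fun hj => hi ((hB i j h0).2 hj)⟩
  · rintro B ⟨hB, hb₁, hb₂⟩ i j u hu hij
    have hc : c i ↔ d j := hB i j (hij ▸ Units.ne_zero u)
    refine ⟨fun i' j' => separation_pivot (W := fun _ => True) (fun i j _ => hB i j) trivial hc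
      i' j' trivial, ?_⟩
    have hB' : ∀ i j, B i j ≠ 0 → (¬ c i ↔ ¬ d j) := fun i j h => not_congr (hB i j h)
    by_cases hi : c i
    · rw [block_pivot hi (hc.1 hi), block_pivot_of_not hB' (not_not.2 hi) (not_not.2 (hc.1 hi))]
      exact ⟨hb₁.pivot hu hij, hb₂⟩
    · have hj : ¬ d j := fun hj => hi (hc.2 hj)
      rw [block_pivot_of_not hB hi hj,
        block_pivot (c := fun i => ¬ c i) (d := fun j => ¬ d j) hi hj]
      exact ⟨hb₁, hb₂.pivot hu hij⟩
  · ext i j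
    have hcd' := hcd i j
    by_cases hi : c i <;> by_cases hj : d j
    · have := congrFun (congrFun hBA₁ ⟨i, hi⟩) ⟨j, hj⟩
      simpa [C, hi, hj] using this
    · have : A i j = 0 := by by_contra h; exact hj ((hcd' h).1 hi)
      simp [C, hi, hj, this]
    · have : A i j = 0 := by by_contra h; exact hi ((hcd' h).2 hj)
      simp [C, hi, hj, this]
    · have := congrFun (congrFun hBA₂ ⟨i, hi⟩) ⟨j, hj⟩
      simpa [C, hi, hj] using this

/-- Uniqueness lets the two lifts be rescaled to agree on the common columns; column `x` of one is
then adjoined to the other. -/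
theorem liftable_of_columns [Finite Y] {A : Matrix X Y (ZMod 11)} (hA : Confined A) {x y : Y}
    (hxy : x ≠ y) (hc : RowConnected (fun j => j ≠ x ∧ j ≠ y) A)
    (hx : Liftable (A.submatrix id (Subtype.val : {j // j ≠ x} → Y)))
    (hy : Liftable (A.submatrix id (Subtype.val : {j // j ≠ y} → Y))) : Liftable A := by
  classical
  obtain ⟨B₁, hB₁, h₁⟩ := hx
  obtain ⟨B₂, hB₂, h₂⟩ := hy
  have h₁' : ∀ i j (h : j ≠ x), toZMod (B₁ i ⟨j, h⟩) = A i j := fun i j h =>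
    congrFun (congrFun h₁ i) ⟨j, h⟩
  have h₂' : ∀ i j (h : j ≠ y), toZMod (B₂ i ⟨j, h⟩) = A i j := fun i j h =>
    congrFun (congrFun h₂ i) ⟨j, h⟩
  let ι₁ : {j // j ≠ x ∧ j ≠ y} → {j // j ≠ x} := fun j => ⟨j.1, j.2.1⟩
  let ι₂ : {j // j ≠ x ∧ j ≠ y} → {j // j ≠ y} := fun j => ⟨j.1, j.2.2⟩
  obtain ⟨s, t, hs, ht, hst⟩ := exists_scaling (hB₂.submatrix id ι₂) (hB₁.submatrix id ι₁) (by
    ext i ⟨j, hjx, hjy⟩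
    exact (h₂' i j hjy).trans (h₁' i j hjx).symm)
  let C : Matrix X Y DyadicRing := Matrix.of fun i j =>
    if h : j = x then (s i : DyadicRing) * B₂ i ⟨x, hxy⟩ else B₁ i ⟨j, h⟩
  -- The scaling `t` covers only the common columns; column `x` is free and gets 1.
  let t' : {j // j ≠ y} → DyadicRing := fun j =>
    if h : j.1 ≠ x then (t ⟨j.1, h, j.2⟩ : DyadicRing) else 1
  have hCA : C.map toZMod = A := by
    ext i j
    by_cases h : j = x
    · subst h
      simp [C, toZMod_of_mem_unitKernel (hs i), h₂']
    · simp [C, h, h₁']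
  have hCx : IsPMatrixOff x C := by
    unfold IsPMatrixOff
    convert hB₁ using 1
    ext i ⟨j, hj⟩
    simp [C, hj]
  have hCy : IsPMatrixOff y C := by
    have := hB₂.scale (fun i => (s i : DyadicRing)) t' (fun i => Mem.of_unit (hs i).1) (by
      intro j
      by_cases h : j.1 = x
      · simp only [t', h, ne_eq, not_true_eq_false, dite_false]; exact Mem.one
      · simp only [t', ne_eq, h, not_false_eq_true, dite_true]; exact Mem.of_unit (ht _).1)
    unfold IsPMatrixOff
    convert this using 1
    ext i ⟨j, hj⟩
    by_cases h : j = x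
    · subst h; simp [C, t']
    · simpa [C, t', h] using hst i ⟨j, h, hj⟩
  refine ⟨C, isPMatrix_of_isPMatrixOff hxy hCx hCy (hCA ▸ hA) ?_, hCA⟩
  intro c d hcd
  refine hc c d fun i j hj h0 => hcd i j hj fun h => h0 ?_
  rw [← hCA]
  simp [h]

theorem liftable_two_by_two {A : Matrix X Y (ZMod 11)} (hA : Confined A) {x x' : X} {y y' : Y}
    (hxx : x ≠ x') (hyy : y ≠ y') (hX : ∀ i, i = x ∨ i = x') (hY : ∀ j, j = y ∨ j = y')
    (h₁ : A x y ≠ 0) (h₂ : A x y' ≠ 0) (h₃ : A x' y ≠ 0) (h₄ : A x' y' ≠ 0) : Liftable A := by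
  classical
  obtain ⟨p, hp, hpA⟩ := exists_crossRatio hA h₁ h₂ h₃ h₄
  have hp0 : p ≠ 0 := by
    rintro rfl
    rw [zero_mul] at hpA
    exact mul_ne_zero h₁ h₄ hpA
  obtain ⟨e, he, rfl⟩ := exists_fundamental_toZMod_eq hp hp0
  obtain ⟨u₁, hu₁, e₁⟩ := exists_unit_toZMod_eq h₁
  obtain ⟨u₂, hu₂, e₂⟩ := exists_unit_toZMod_eq h₂
  obtain ⟨u₃, hu₃, e₃⟩ := exists_unit_toZMod_eq h₃
  -- Three entries are lifted arbitrarily; `w` is solved for so that the ratio of the determinant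
  -- terms is the fundamental lift `e` of the cross ratio.
  let w : DyadicRing := e * (u₂ * u₃) * ((u₁⁻¹ : DyadicRingˣ) : DyadicRing)
  have M₁ := Mem.of_unit hu₁
  have M₂ := Mem.of_unit hu₂
  have M₃ := Mem.of_unit hu₃
  have Mw : dyadicField.Mem w :=
    (he.mem.mul (M₂.mul M₃)).mul (Mem.of_unit (dyadicField.G.inv_mem hu₁))
  have hw : u₁ * w = e * (u₂ * u₃) := by
    simp only [w]
    rw [mul_comm, mul_assoc, Units.inv_mul, mul_one]
  have Md : dyadicField.Mem (u₁ * w - u₂ * u₃) := by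
    have : u₁ * w - u₂ * u₃ = (e - 1) * (u₂ * u₃) := by rw [hw]; ring
    rw [this]
    exact he.sub_one_mem.mul (M₂.mul M₃)
  have e₄ : toZMod w = A x' y' := by
    refine mul_left_cancel₀ h₁ ?_
    rw [hpA, ← e₁, ← e₂, ← e₃, ← map_mul, hw]
    simp
  let C : Matrix X Y DyadicRing := Matrix.of fun i j =>
    if i = x then if j = y then (u₁ : DyadicRing) else u₂ else if j = y then (u₃ : DyadicRing) else w
  have c₁ : C x y = u₁ := by simp [C]
  have c₂ : C x y' = u₂ := by simp [C, hyy.symm]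
  have c₃ : C x' y = u₃ := by simp [C, hxx.symm]
  have c₄ : C x' y' = w := by simp [C, hxx.symm, hyy.symm]
  refine ⟨C, ?_, ?_⟩
  · intro k f g
    have hk : k ≤ 2 := by
      have h1 : (Finset.univ.map f) ⊆ {x, x'} := by
        intro i _
        simpa using hX i
      have h2 := (Finset.card_le_card h1).trans Finset.card_le_two
      simpa using h2
    have h0 : ∀ i j, dyadicField.Mem (C i j) := by
      intro i j
      rcases hX i with rfl | rfl <;> rcases hY j with rfl | rfl
      exacts [c₁ ▸ M₁, c₂ ▸ M₂, c₃ ▸ M₃, c₄ ▸ Mw]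
    interval_cases k
    · simpa using Mem.one
    · simpa using h0 _ _
    · have hf : f 0 ≠ f 1 := f.injective.ne (by decide)
      have hg : g 0 ≠ g 1 := g.injective.ne (by decide)
      rw [Matrix.det_fin_two]
      simp only [Matrix.submatrix_apply]
      rcases hX (f 0) with a | a <;> rcases hX (f 1) with b | b <;>
        rcases hY (g 0) with c | c <;> rcases hY (g 1) with d | d <;>
        simp only [a, b, c, d, ne_eq, not_true_eq_false] at hf hg <;>
        rw [a, b, c, d, c₁, c₂, c₃, c₄]
      · exact Md
      · convert Md.neg using 1; ring
      · convert Md.neg using 1; ring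
      · convert Md using 1; ring
  · ext i j
    rcases hX i with rfl | rfl <;> rcases hY j with rfl | rfl
    · simp [c₁, e₁]
    · simp [c₂, e₂]
    · simp [c₃, e₃]
    · simp [c₄, e₄]

end DyadicRing

/-! ### The induction -/

namespace DyadicRing

open PartialField

/-- All confined matrices with fewer than `N` rows and columns are liftable. -/
def LiftableBelow (N : ℕ) : Prop :=
  ∀ (X Y : Type) [Finite X] [Finite Y] (A : Matrix X Y (ZMod 11)),
    Nat.card X + Nat.card Y < N → Confined A → Liftable A

theorem LiftableBelow.swap {X Y : Type} (ih : LiftableBelow (Nat.card X + Nat.card Y)) :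
    LiftableBelow (Nat.card Y + Nat.card X) := by
  rwa [add_comm]

section Existence

variable {X Y : Type} [Finite X] [Finite Y] {A : Matrix X Y (ZMod 11)}

theorem liftable_of_columns_of_below (ih : LiftableBelow (Nat.card X + Nat.card Y))
    (hA : Confined A) {x y : Y} (hxy : x ≠ y)
    (hc : RowConnected (fun j => j ≠ x ∧ j ≠ y) A) : Liftable A := by
  have key : ∀ x : Y, Liftable (A.submatrix id (Subtype.val : {j // j ≠ x} → Y)) := fun x =>
    ih _ _ _ (Nat.add_lt_add_left (Finite.card_subtype_lt (x := x) (by simp)) _)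
      (hA.submatrix (Function.Embedding.refl X) (Function.Embedding.subtype _))
  exact liftable_of_columns hA hxy hc (key x) (key y)

theorem liftable_of_row_of_below (ih : LiftableBelow (Nat.card X + Nat.card Y))
    (hA : Confined A) (i : X) (hi : ∀ j j', A i j ≠ 0 → A i j' ≠ 0 → j = j') : Liftable A :=
  liftable_of_row i hi (ih _ _ _ (Nat.add_lt_add_right (Finite.card_subtype_lt (x := i) (by simp)) _)
    (hA.submatrix (Function.Embedding.subtype _) (Function.Embedding.refl Y)))

theorem liftable_of_three (ih : LiftableBelow (Nat.card X + Nat.card Y)) (hA : Confined A)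
    (hc : IsConnected A) {w : X ⊕ Y} {nb : Fin 3 → X ⊕ Y} (hnb : Function.Injective nb)
    (hadj : ∀ a, (supportGraph A).Adj w (nb a)) : Liftable A := by
  rcases hc.exists_pair hnb hadj with ⟨x, y, hxy, h⟩ | ⟨x, y, hxy, h⟩
  · exact liftable_of_columns_of_below ih hA hxy h
  · exact (liftable_of_columns_of_below ih.swap hA.transpose hxy h).transpose

theorem injective_vec_three {Z : Type} {a b c : Z} (hab : a ≠ b) (hac : a ≠ c) (hbc : b ≠ c) :
    Function.Injective ![a, b, c] := by
  intro i j
  fin_cases i <;> fin_cases j <;> simp [hab, hac, hbc, hab.symm, hac.symm, hbc.symm]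

theorem liftable_of_row_three (ih : LiftableBelow (Nat.card X + Nat.card Y)) (hA : Confined A)
    (hc : IsConnected A) {i : X} {a b c : Y} (hab : a ≠ b) (hac : a ≠ c) (hbc : b ≠ c)
    (ha : A i a ≠ 0) (hb : A i b ≠ 0) (hc' : A i c ≠ 0) : Liftable A := by
  refine liftable_of_three ih hA hc (w := Sum.inl i) (nb := fun k => Sum.inr (![a, b, c] k))
    (Sum.inr_injective.comp (injective_vec_three hab hac hbc)) ?_
  intro k
  fin_cases k <;> simpa

theorem liftable_of_not_connected (ih : LiftableBelow (Nat.card X + Nat.card Y))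
    (hA : Confined A) (hc : ¬ IsConnected A) : Liftable A := by
  simp only [IsConnected] at hc
  push Not at hc
  obtain ⟨c, d, hcd, a, b, ha, hb⟩ := hc
  have le : ∀ {Z : Type} [Finite Z] (p : Z → Prop), Nat.card {z // p z} ≤ Nat.card Z :=
    fun p => Finite.card_subtype_le p
  refine liftable_of_separation hcd (ih _ _ _ ?_ (hA.submatrix (.subtype _) (.subtype _)))
    (ih _ _ _ ?_ (hA.submatrix (.subtype _) (.subtype _)))
  · rcases b with i | j
    · exact Nat.add_lt_add_of_lt_of_le (Finite.card_subtype_lt hb) (le _)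
    · exact Nat.add_lt_add_of_le_of_lt (le _) (Finite.card_subtype_lt hb)
  · rcases a with i | j
    · exact Nat.add_lt_add_of_lt_of_le (Finite.card_subtype_lt (not_not.2 ha)) (le _)
    · exact Nat.add_lt_add_of_le_of_lt (le _) (Finite.card_subtype_lt (not_not.2 ha))

/-- In a counterexample the support is connected and every degree is exactly two, so it is a cycle.
-/
theorem liftable_step (ih : LiftableBelow (Nat.card X + Nat.card Y)) (hA : Confined A) :
    Liftable A := by
  rcases isEmpty_or_nonempty X with hX | ⟨⟨x⟩⟩
  · exact liftable_of_isEmpty A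
  by_cases hc : IsConnected A
  swap
  · exact liftable_of_not_connected ih hA hc
  by_contra hL
  have hrow : ∀ i, ∃ j j', A i j ≠ 0 ∧ A i j' ≠ 0 ∧ j ≠ j' := by
    by_contra h
    push Not at h
    obtain ⟨i, hi⟩ := h
    exact hL (liftable_of_row_of_below ih hA i hi)
  have hcol : ∀ j, ∃ i i', A i j ≠ 0 ∧ A i' j ≠ 0 ∧ i ≠ i' := by
    by_contra h
    push Not at h
    obtain ⟨j, hj⟩ := h
    exact hL (liftable_of_row_of_below ih.swap hA.transpose j hj).transpose
  have row3 : ∀ {i a b c}, A i a ≠ 0 → A i b ≠ 0 → a ≠ b → A i c ≠ 0 → c = a ∨ c = b := by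
    intro i a b c ha hb hab hc'
    by_contra! h
    exact hL (liftable_of_row_three ih hA hc hab h.1.symm h.2.symm ha hb hc')
  have col3 : ∀ {j a b c}, A a j ≠ 0 → A b j ≠ 0 → a ≠ b → A c j ≠ 0 → c = a ∨ c = b := by
    intro j a b c ha hb hab hc'
    by_contra! h
    exact hL (liftable_of_row_three ih.swap hA.transpose hc.transpose hab h.1.symm h.2.symm ha hb
      hc').transpose
  obtain ⟨y, y', hy, hy', hyy⟩ := hrow x
  obtain ⟨x', hx', hxx⟩ : ∃ x', A x' y ≠ 0 ∧ x ≠ x' := by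
    obtain ⟨i, i', hi, hi', hii⟩ := hcol y
    by_cases h : x = i
    · exact ⟨i', hi', h ▸ hii⟩
    · exact ⟨i, hi, h⟩
  -- A zero here means that the cycle is longer than four.
  by_cases h0 : A x' y' = 0
  · obtain ⟨y'', hy'', hne⟩ : ∃ y'', A x' y'' ≠ 0 ∧ y'' ≠ y := by
      obtain ⟨j, j', hj, hj', hjj⟩ := hrow x'
      by_cases h : j = y
      · exact ⟨j', hj', h ▸ hjj.symm⟩
      · exact ⟨j, hj, h⟩
    have hne' : y'' ≠ y' := by rintro rfl; exact hy'' h0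
    have hx0 : A x y'' = 0 := by
      by_contra h
      exact (row3 hy hy' hyy h).elim hne hne'
    have hu : A x y = (Units.mk0 _ hy : (ZMod 11)ˣ) := rfl
    -- After the pivot, row `x'` is nonzero at `y`, at `y'` by fill-in, and at `y''`, where it is
    -- unchanged.
    refine hL (liftable_of_pivot hu (liftable_of_row_three ih (hA.pivot hu) (hc.pivot hu) (i := x')
      hyy hne.symm hne'.symm ?_ ?_ ?_))
    · rw [pivot_col _ _ _ _ hxx.symm, neg_ne_zero]
      exact mul_ne_zero (Units.ne_zero _) hx'
    · rw [pivot_off _ _ _ _ hxx.symm hyy.symm, h0, zero_sub, neg_ne_zero]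
      exact mul_ne_zero (mul_ne_zero (Units.ne_zero _) hx') hy'
    · rwa [pivot_of_row_eq_zero hne hx0]
  -- The four-cycle is closed under adjacency, so by connectedness it is the whole support.
  · have hsep := hc (fun i => i = x ∨ i = x') (fun j => j = y ∨ j = y') (by
      intro i j hij
      constructor
      · rintro (rfl | rfl)
        · exact row3 hy hy' hyy hij
        · exact row3 hx' h0 hyy hij
      · rintro (rfl | rfl)
        · exact col3 hy hx' hxx hij
        · exact col3 hy' h0 hxx hij) (Sum.inl x)
    exact hL (liftable_two_by_two hA hxx hyy (fun i => hsep (Sum.inl i) (Or.inl rfl))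
      (fun j => hsep (Sum.inr j) (Or.inl rfl)) hy hy' hx' h0)

/-- A confined matrix over `GF(11)` is the reduction of a matrix over the dyadic partial field. -/
theorem Confined.liftable (hA : Confined A) : Liftable A := by
  have key : ∀ N, LiftableBelow N := by
    intro N
    induction N with
    | zero => intro X Y _ _ A h; omega
    | succ N ih =>
      intro X Y _ _ A h hA
      refine liftable_step (fun X' Y' _ _ A' h' => ih X' Y' A' (by omega)) hA
  exact key _ X Y A (Nat.lt_succ_self _) hA

end Existence

/-- Determinants commute with reduction, and nonzero dyadic ones stay nonzero. -/
theorem basisFamily_map {X Y : Type} {B : Matrix X Y DyadicRing} (hB : dyadicField.IsPMatrix B) :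
    basisFamily (B.map toZMod) = basisFamily B := by
  have : ∀ (k : ℕ) (f : Fin k ↪ X) (g : Fin k ↪ Y),
      ((B.map toZMod).submatrix f g).det ≠ 0 ↔ (B.submatrix f g).det ≠ 0 := by
    intro k f g
    rw [Matrix.submatrix_map, ← RingHom.mapMatrix_apply, ← RingHom.map_det, Ne,
      toZMod_eq_zero (hB k f g)]
  simp only [basisFamily, this]

theorem isPMatrix_ofField {X Y : Type} {K : Type*} [Field K] (A : Matrix X Y K) : (ofField K).IsPMatrix A := by
  intro k f g
  by_cases h : (A.submatrix f g).det = 0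
  · exact Or.inl h
  · exact Or.inr ⟨Units.mk0 _ h, Subgroup.mem_top _, rfl⟩

end DyadicRing

theorem mainTheorem6 {α : Type*} (M : Matroid α) [M.Finite] :
    M.IsDyadic ↔
      (PartialField.ofField (ZMod 11)).HasConfinedRepresentation {2, 6, 10} M := by
  constructor
  · rintro ⟨X, Y, hX, hY, A, hA, e, he, h⟩
    refine ⟨X, Y, hX, hY, Matrix.map (α := DyadicRing) A DyadicRing.toZMod,
      ⟨DyadicRing.isPMatrix_ofField _, e, he, fun B => ?_⟩, DyadicRing.isConfined_map hA⟩
    rw [h B, DyadicRing.basisFamily_map hA]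
    rfl
  · rintro ⟨X, Y, hX, hY, A, ⟨-, e, he, h⟩, hA⟩
    obtain ⟨B, hB, rfl⟩ := DyadicRing.Confined.liftable hA
    refine ⟨X, Y, hX, hY, B, hB, e, he, fun S => ?_⟩
    rw [h S, DyadicRing.basisFamily_map hB]
    rfl
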